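/- Let $p\ge 1$ and $r\ge 2p-1$ be integers, let $\gamma>0$, and let $\Omega\subset\mathbb R^2$ be a convex polygonal domain. A mesh $\Omega_h$ of $\Omega$ is a finite collection of nonoverlapping open (simple) polygons $K$ whose closures cover $\overline\Omega$; $h_K$ denotes the diameter of $K$ and $h=\max_{K\in\Omega_h}h_K$. The mesh is called $\gamma$-regular if every $K\in\Omega_h$ is star-shaped with respect to every point of some ball of radius $\gamma h_K$. Write $\mathbb P_k$ for the polynomials of total degree at most $k$ (with $\mathbb P_{k}=\{0\}$ for $k<0$), $|w|_{m}=\big(\sum_{|\nu|=m}\|D^\nu w\|_{L^2(\Omega)}^2\big)^{1/2}$, and $H^p_0(\Omega)=\{v\in H^p(\Omega):\partial_n^jv=0\text{ on }\partial\Omega,\ j=0,\dots,p-1\}$ (in the sense of traces). The local virtual element space $V_{h,r}^p(K)$ consists of all $v\in H^p(K)$ such that $\Delta^pv\in\mathbb P_{r-2p}(K)$, the traces satisfy $D^\nu v\in C^0(\partial K)$ for $|\nu|\le p-1$, and $\partial_n^jv\in\mathbb P_{r-j}(e)$ for $j=0,\dots,p-1$ and every edge $e$ of $K$. The global virtual element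 space is $$V_{h,r}^p=\{v\in H^p_0(\Omega): v|_K\in V_{h,r}^p(K)\ \text{for all } K\in\Omega_h\}.$$ For $f\in L^2(\Omega)$ let $f_h$ be the piecewise polynomial whose restriction to each $K\in\Omega_h$ is the $L^2(K)$-orthogonal projection of $f$ onto $\mathbb P_{r-p}(K)$, and put $\langle f-f_h,v\rangle=\int_\Omega fv\,dx-\sum_{K\in\Omega_h}\int_K f_hv\,dx$. Then there is a constant $C>0$, depending only on $\Omega$, $p$, $r$ and $\gamma$ (in particular independent of $h$), such that for every $\gamma$-regular mesh $\Omega_h$ of $\Omega$, every $f\in H^{r-p+1}(\Omega)$ and every $v_h\in V_{h,r}^p$, $$\langle f-f_h,v_h\rangle\le C\,h^{r+1}\,|f|_{r-p+1}\,|v_h|_{p}.$$ -/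

import Mathlib

open MeasureTheory Set Filter Topology
open scoped ContDiff ENNReal

noncomputable section

namespace PolyVEM

/-- The Euclidean plane. -/
abbrev Plane : Type := EuclideanSpace ℝ (Fin 2)

/-! ### Classical and weak derivatives, Sobolev spaces -/

/-- The classical partial derivative `∂ᵢ φ`. -/
def partialD (i : Fin 2) (φ : Plane → ℝ) : Plane → ℝ :=
  fun x => fderiv ℝ φ x (EuclideanSpace.single i 1)

/-- The classical derivative `D^ν φ` for a multi-index `ν = (ν₁, ν₂)`. -/
def classicalD (ν : ℕ × ℕ) (φ : Plane → ℝ) : Plane → ℝ :=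
  (partialD 0)^[ν.1] ((partialD 1)^[ν.2] φ)

/-- `φ ∈ C_c^∞(U)`. -/
def IsTestFunction (U : Set Plane) (φ : Plane → ℝ) : Prop :=
  ContDiff ℝ ∞ φ ∧ HasCompactSupport φ ∧ tsupport φ ⊆ U

/-- `g` is a square-integrable weak derivative `D^ν u` on the open set `U`. -/
def IsWeakDeriv (U : Set Plane) (ν : ℕ × ℕ) (u g : Plane → ℝ) : Prop :=
  MemLp g 2 (volume.restrict U) ∧
    ∀ φ, IsTestFunction U φ →
      ∫ x in U, u x * classicalD ν φ x = (-1) ^ (ν.1 + ν.2) * ∫ x in U, g x * φ x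

/-- `u ∈ H^m(U)`. Functions are defined on the whole plane, only their values on `U` matter. -/
def MemH (m : ℕ) (U : Set Plane) (u : Plane → ℝ) : Prop :=
  MemLp u 2 (volume.restrict U) ∧
    ∀ ν : ℕ × ℕ, ν.1 + ν.2 ≤ m → ∃ g, IsWeakDeriv U ν u g

open Classical in
/-- The weak derivative `D^ν u` on `U` (a representative of it; `0` if there is none in `L²(U)`). -/
def weakD (U : Set Plane) (ν : ℕ × ℕ) (u : Plane → ℝ) : Plane → ℝ :=
  if h : ∃ g, IsWeakDeriv U ν u g then h.choose else 0

/-- The seminorm `|u|_{m,U} = (∑_{|ν| = m} ‖D^ν u‖²_{L²(U)})^{1/2}`. -/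
def seminormH (m : ℕ) (U : Set Plane) (u : Plane → ℝ) : ℝ :=
  Real.sqrt (∑ ν ∈ Finset.HasAntidiagonal.antidiagonal m, ∫ x in U, (weakD U ν u x) ^ 2)

/-- The first-order multi-index in the direction `i`. -/
def unitIndex (i : Fin 2) : ℕ × ℕ := if i = 0 then (1, 0) else (0, 1)

/-- `g` is the trace of `w ∈ H¹(U)` on the curve `S ⊆ ∂U`: some sequence of functions in
`C^∞(ℝ²)` tends to `w` in `H¹(U)` and to `g` in `L²(S)` (arc length measure). -/
def HasTraceOn (U S : Set Plane) (w g : Plane → ℝ) : Prop :=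
  MemH 1 U w ∧ MemLp g 2 ((μH[1] : Measure Plane).restrict S) ∧
    ∃ φ : ℕ → Plane → ℝ, (∀ k, ContDiff ℝ ∞ (φ k)) ∧
      Tendsto (fun k => eLpNorm (φ k - w) 2 (volume.restrict U)) atTop (𝓝 0) ∧
      (∀ i, Tendsto (fun k => eLpNorm (partialD i (φ k) - weakD U (unitIndex i) w) 2
        (volume.restrict U)) atTop (𝓝 0)) ∧
      Tendsto (fun k => eLpNorm (φ k - g) 2 ((μH[1] : Measure Plane).restrict S)) atTop (𝓝 0)

/-- The `j`-th derivative of `u` in the constant direction `n`,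
`∂_n^j u = ∑_{ν₁ + ν₂ = j} (j choose ν₁) n₁^ν₁ n₂^ν₂ D^ν u`. -/
def directionalD (U : Set Plane) (n : Plane) (j : ℕ) (u : Plane → ℝ) : Plane → ℝ :=
  fun x => ∑ ν ∈ Finset.HasAntidiagonal.antidiagonal j,
    (j.choose ν.1 : ℝ) * n 0 ^ ν.1 * n 1 ^ ν.2 * weakD U ν u x

/-! ### Polynomials and the `L²`-orthogonal projection -/

/-- The space `ℙ_k` of bivariate polynomials of total degree at most `k`; it is `{0}` for `k < 0`. -/
def polySpace (k : ℤ) : Submodule ℝ (MvPolynomial (Fin 2) ℝ) :=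
  if k < 0 then ⊥ else MvPolynomial.restrictTotalDegree (Fin 2) ℝ k.toNat

/-- The polynomial function of a bivariate polynomial. -/
def polyFun (q : MvPolynomial (Fin 2) ℝ) : Plane → ℝ :=
  fun x => MvPolynomial.eval (fun i => x i) q

/-- `q` is the `L²(K)`-orthogonal projection of `f` onto `ℙ_k(K)`. -/
def IsL2Projection (K : Set Plane) (k : ℤ) (f : Plane → ℝ)
    (q : MvPolynomial (Fin 2) ℝ) : Prop :=
  q ∈ polySpace k ∧ ∀ s ∈ polySpace k, ∫ x in K, (f x - polyFun q x) * polyFun s x = 0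

open Classical in
/-- The `L²(K)`-orthogonal projection `Π⁰_k f` of `f` onto `ℙ_k(K)`. -/
def l2Projection (K : Set Plane) (k : ℤ) (f : Plane → ℝ) : MvPolynomial (Fin 2) ℝ :=
  if h : ∃ q, IsL2Projection K k f q then h.choose else 0

instance polySpace_finite (k : ℤ) : Module.Finite ℝ (polySpace k) := by
  unfold polySpace
  by_cases h : k < 0
  · rw [if_pos h]
    infer_instance
  · rw [if_neg h]
    infer_instance

lemma continuous_polyFun (q : MvPolynomial (Fin 2) ℝ) : Continuous (polyFun q) := by
  unfold polyFun
  exact (MvPolynomial.continuous_eval q).comp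
    (continuous_pi fun i => PiLp.continuous_apply 2 (fun _ : Fin 2 => ℝ) i)

lemma memLp_polyFun {K : Set Plane} (hK : Bornology.IsBounded K)
    (q : MvPolynomial (Fin 2) ℝ) : MemLp (polyFun q) 2 (volume.restrict K) := by
  have hc : IsCompact (closure K) := hK.isCompact_closure
  have h : MemLp (polyFun q) 2 (volume.restrict (closure K)) := by
    obtain ⟨C, hC⟩ := hc.exists_bound_of_continuousOn (continuous_polyFun q).continuousOn
    have : IsFiniteMeasure (volume.restrict (closure K)) :=
      ⟨by simpa using hc.measure_lt_top⟩
    refine MemLp.of_bound (continuous_polyFun q).aestronglyMeasurable C ?_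
    filter_upwards [ae_restrict_mem isClosed_closure.measurableSet] with x hx using hC x hx
  exact h.mono_measure (Measure.restrict_mono subset_closure le_rfl)

/-- The `L²`-orthogonal projection onto polynomials exists, so `l2Projection` is it. -/
theorem isL2Projection_l2Projection {K : Set Plane} (hK : Bornology.IsBounded K) (k : ℤ)
    {f : Plane → ℝ} (hf : MemLp f 2 (volume.restrict K)) :
    IsL2Projection K k f (l2Projection K k f) := by
  have hex : ∃ q, IsL2Projection K k f q := by
    let T : polySpace k →ₗ[ℝ] Lp ℝ 2 (volume.restrict K) :=
      { toFun := fun q => (memLp_polyFun hK q.1).toLp _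
        map_add' := fun a b => by
          rw [← MemLp.toLp_add]
          congr 1
          ext x
          simp [polyFun]
        map_smul' := fun c a => by
          rw [RingHom.id_apply, ← MemLp.toLp_const_smul]
          congr 1
          ext x
          simp [polyFun] }
    obtain ⟨q, hq⟩ : (LinearMap.range T).starProjection (hf.toLp f) ∈ LinearMap.range T :=
      Submodule.starProjection_apply_mem _ _
    refine ⟨q.1, q.2, fun s hs => ?_⟩
    have h0 := Submodule.starProjection_inner_eq_zero (K := LinearMap.range T) (hf.toLp f)
      (T ⟨s, hs⟩) ⟨_, rfl⟩
    rw [← hq, L2.inner_def] at h0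
    rw [← h0]
    refine integral_congr_ae ?_
    have e1 := hf.coeFn_toLp
    have e2 := (memLp_polyFun hK q.1).coeFn_toLp
    have e3 := (memLp_polyFun hK s).coeFn_toLp
    have e4 := Lp.coeFn_sub (hf.toLp f) (T q)
    filter_upwards [e1, e2, e3, e4] with x h1 h2 h3 h4
    have h2' : (T q : Plane → ℝ) x = polyFun q.1 x := h2
    have h3' : (T ⟨s, hs⟩ : Plane → ℝ) x = polyFun s x := h3
    rw [h4, Pi.sub_apply, h1, h2', h3']
    simp [mul_comm]
  unfold l2Projection
  rw [dif_pos hex]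
  exact hex.choose_spec

/-! ### Polygons and meshes -/

/-- A polygonal domain: the bounded open region enclosed by a simple closed polygonal chain.
Consecutive edges may be collinear. -/
structure PolygonalDomain where
  /-- The number of vertices (and of edges). -/
  n : ℕ
  three_le : 3 ≤ n
  /-- The closed polygonal chain; its `i`-th edge joins vertex `i` and vertex `i + 1` (cyclically). -/
  chain : Polygon Plane n
  vertices_injective : Function.Injective chain.vertices
  consecutive : ∀ i, chain.edgeSet ℝ i ∩ chain.edgeSet ℝ (finRotate n i) = {chain (finRotate n i)}
  nonconsecutive : ∀ i j, j ≠ i → j ≠ finRotate n i → i ≠ finRotate n j →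
    Disjoint (chain.edgeSet ℝ i) (chain.edgeSet ℝ j)
  /-- The enclosed open region. -/
  carrier : Set Plane
  isOpen_carrier : IsOpen carrier
  isConnected_carrier : IsConnected carrier
  isBounded_carrier : Bornology.IsBounded carrier
  frontier_carrier : frontier carrier = chain.boundary ℝ

namespace PolygonalDomain

/-- The diameter `h_K`. -/
def diam (K : PolygonalDomain) : ℝ := Metric.diam K.carrier

/-- The `i`-th edge of the polygon, a closed segment. -/
def edge (K : PolygonalDomain) (i : Fin K.n) : Set Plane := K.chain.edgeSet ℝ i

/-- A unit normal of the `i`-th edge. (Its orientation is irrelevant for the spaces below, since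
`∂_n^j` only changes sign by `(-1)^j`.) -/
def normal (K : PolygonalDomain) (i : Fin K.n) : Plane :=
  let d := K.chain (finRotate K.n i) - K.chain i
  ‖d‖⁻¹ • !₂[d 1, -d 0]

end PolygonalDomain

/-- A decomposition of `Ω` into finitely many nonoverlapping polygons. -/
structure Mesh (Ω : PolygonalDomain) where
  /-- The number of elements. -/
  card : ℕ
  /-- The (open) elements. -/
  cell : Fin card → PolygonalDomain
  nonoverlapping : ∀ i j, i ≠ j → Disjoint (cell i).carrier (cell j).carrier
  covers : ⋃ i, closure (cell i).carrier = closure Ω.carrier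

/-- The mesh size `h = max_K h_K`. -/
def Mesh.size {Ω : PolygonalDomain} (T : Mesh Ω) : ℝ := ⨆ i, (T.cell i).diam

/-- Mesh regularity with constant `γ`: each element `K` is star-shaped with respect to every point
of a ball of radius `γ h_K`. -/
def Mesh.IsRegular {Ω : PolygonalDomain} (T : Mesh Ω) (γ : ℝ) : Prop :=
  ∀ i, ∃ c : Plane, ∀ z ∈ Metric.ball c (γ * (T.cell i).diam), StarConvex ℝ z (T.cell i).carrier

/-! ### Virtual element spaces -/

/-- `v ∈ H^p_0(Ω)`: `v ∈ H^p(Ω)` and `∂_n^j v = 0` on `∂Ω` for `j = 0, …, p - 1`. -/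
def MemH0 (p : ℕ) (Ω : PolygonalDomain) (v : Plane → ℝ) : Prop :=
  MemH p Ω.carrier v ∧
    ∀ i, ∀ j < p, HasTraceOn Ω.carrier (Ω.edge i) (directionalD Ω.carrier (Ω.normal i) j v) 0

/-- `v` belongs to the local virtual element space of the element `K`:
`v ∈ H^p(K)`, `Δ^p v ∈ ℙ_{r-2p}(K)` (in the sense of distributions), `D^ν v ∈ C⁰(∂K)` for
`|ν| ≤ p - 1`, and `∂_n^j v ∈ ℙ_{r-j}(e)` for each edge `e` of `K` and `j = 0, …, p - 1`. -/
def MemLocalVEM (p r : ℕ) (K : PolygonalDomain) (v : Plane → ℝ) : Prop :=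
  MemH p K.carrier v ∧
  (∃ q ∈ polySpace ((r : ℤ) - 2 * p), ∀ φ, IsTestFunction K.carrier φ →
    ∫ x in K.carrier, v x * (Laplacian.laplacian^[p] φ) x =
      ∫ x in K.carrier, polyFun q x * φ x) ∧
  (∀ ν : ℕ × ℕ, ν.1 + ν.2 < p → ∃ g : Plane → ℝ, ContinuousOn g (frontier K.carrier) ∧
    HasTraceOn K.carrier (frontier K.carrier) (weakD K.carrier ν v) g) ∧
  (∀ i, ∀ j < p, ∃ q ∈ polySpace ((r : ℤ) - j),
    HasTraceOn K.carrier (K.edge i) (directionalD K.carrier (K.normal i) j v) (polyFun q))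

/-- `v` belongs to the global conforming virtual element space: `v ∈ H^p_0(Ω)`, and the restriction
of `v` to each element lies in the local space. -/
def MemGlobalVEM (p r : ℕ) {Ω : PolygonalDomain} (T : Mesh Ω) (v : Plane → ℝ) : Prop :=
  MemH0 p Ω v ∧ ∀ i, MemLocalVEM p r (T.cell i) v

/-! ### The load term -/

/-- `⟨f, v⟩ = ∫_Ω f v dx`. -/
def loadPairing (Ω : PolygonalDomain) (f v : Plane → ℝ) : ℝ :=
  ∫ x in Ω.carrier, f x * v x

/-- `⟨f_h, v⟩ = ∑_K ∫_K f_h v dx`, where `f_h = Π⁰_k f` on each element `K`. -/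
def discreteLoadPairing {Ω : PolygonalDomain} (T : Mesh Ω) (k : ℤ) (f v : Plane → ℝ) : ℝ :=
  ∑ i, ∫ x in (T.cell i).carrier, polyFun (l2Projection (T.cell i).carrier k f) x * v x

end PolyVEM

end

/-! On each element `K` the error `f - f_h` is orthogonal to `ℙ_{r-p}`, so `∫_K (f - f_h) v = ∫_K (f
- f_h)(v - q)` for every `q` of degree at most `r - p`. Since `r ≥ 2p - 1`, the degree `p - 1` is
admissible, and `q` may be an approximant of `v` of that degree. Cauchy–Schwarz and the
best-approximation property of `f_h` leave two polynomial approximation errors: of order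
`h_K^{r-p+1}` for `f` and `h_K^p` for `v`. The exponents add up to `r + 1`, and the elements are
summed by the discrete Cauchy–Schwarz inequality (`integral_sub_l2Projection_mul_le`,
`Mesh.exists_poly_sum_sub_sq_le`).

The approximation result is a Bramble–Hilbert lemma whose constant depends only on `γ` and the order
(`exists_poly_lintegral_sub_sq_le`). It iterates a Poincaré inequality with explicit constant:
subtract a polynomial whose top-order derivatives are the Poincaré constants, then lower the order
by one.

The Poincaré inequality (`exists_const_lintegral_sub_sq_le`) compares `w x`, `x ∈ K`, with `w y`,
`y` in the ball with respect to which `K` is star-shaped. The segment from `y` to `x` stays in `K`,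
so for smooth `w` the mean value theorem bounds the difference by the gradient along it. Integrating
over `x`, `y` and the segment parameter costs only a bounded Jacobian (`lintegral_segment_le`).
Weakly differentiable functions are mollified; this is legitimate on slightly shrunken copies of
`K`, and Fatou's lemma passes to the limit. -/

namespace PolyVEM

/-! ### Integral inequalities -/

/-- The Cauchy–Schwarz inequality against a constant. -/
lemma sq_lintegral_le {α : Type*} [MeasurableSpace α] {μ : Measure α} {g : α → ℝ≥0∞}
    (hg : AEMeasurable g μ) : (∫⁻ x, g x ∂μ) ^ 2 ≤ μ univ * ∫⁻ x, g x ^ 2 ∂μ := by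
  have h := ENNReal.lintegral_mul_le_Lp_mul_Lq μ Real.HolderConjugate.two_two
    (aemeasurable_const (b := (1 : ℝ≥0∞))) hg
  simp only [Pi.mul_apply, one_mul, ENNReal.one_rpow, lintegral_const] at h
  calc (∫⁻ x, g x ∂μ) ^ 2 ≤ _ := pow_le_pow_left' h 2
    _ = _ := by
      rw [mul_pow, ← ENNReal.rpow_natCast, ← ENNReal.rpow_natCast, ← ENNReal.rpow_mul,
        ← ENNReal.rpow_mul]
      norm_num

lemma lintegral_comp_add_smul (F : Plane → ℝ≥0∞) (hF : Measurable F) (a : Plane) {c : ℝ}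
    (hc : c ≠ 0) : ∫⁻ x, F (a + c • x) = ENNReal.ofReal ((c ^ 2)⁻¹) * ∫⁻ x, F x := by
  have h1 : ∫⁻ x, F (a + c • x) = ∫⁻ y, F (a + y) ∂(Measure.map (c • ·) volume) := by
    rw [lintegral_map (by fun_prop) (by fun_prop)]
  have hfin : Module.finrank ℝ Plane = 2 := finrank_euclideanSpace_fin
  rw [h1, Measure.map_addHaar_smul volume hc, lintegral_smul_measure, hfin,
    abs_of_nonneg (by positivity), lintegral_add_left_eq_self, smul_eq_mul]

/-- For fixed `y` the map `x ↦ y + t • (x - y)` is affine with Jacobian `t ^ 2 ≥ 1 / 4`, whence the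
factor 4. The bound would degenerate as `t → 0`, so small `t` is treated by exchanging the roles of
the two sets. -/
lemma lintegral_segment_le_left {F : Plane → ℝ≥0∞} (hF : Measurable F) (S B : Set Plane)
    {t : ℝ} (ht : 1 / 2 ≤ t) :
    ∫⁻ x in S, ∫⁻ y in B, F (y + t • (x - y)) ≤ 4 * volume B * ∫⁻ z, F z := by
  have hm : Measurable fun q : Plane × Plane => F (q.2 + t • (q.1 - q.2)) := by fun_prop
  rw [lintegral_lintegral_swap hm.aemeasurable]
  calc _ ≤ ∫⁻ y in B, 4 * ∫⁻ z, F z := by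
        refine lintegral_mono fun y => (setLIntegral_le_lintegral _ _).trans ?_
        have : ∀ x : Plane, y + t • (x - y) = (y - t • y) + t • x := fun x => by
          rw [smul_sub]; abel
        simp only [this]
        rw [lintegral_comp_add_smul F hF _ (by linarith)]
        gcongr
        rw [show (4 : ℝ≥0∞) = ENNReal.ofReal 4 by norm_num]
        refine ENNReal.ofReal_le_ofReal ?_
        rw [inv_le_comm₀ (by positivity) (by norm_num)]
        nlinarith
    _ = _ := by
        rw [lintegral_const, Measure.restrict_apply_univ]; ring

/-- Averaging a nonnegative function over all segments between two sets. -/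
lemma lintegral_segment_le {F : Plane → ℝ≥0∞} (hF : Measurable F) (S B : Set Plane) :
    ∫⁻ x in S, ∫⁻ y in B, ∫⁻ t in Ioc (0 : ℝ) 1, F (y + t • (x - y)) ≤
      4 * (volume S + volume B) * ∫⁻ z, F z := by
  have hm : Measurable fun q : (Plane × Plane) × ℝ => F (q.1.2 + q.2 • (q.1.1 - q.1.2)) := by
    fun_prop
  have hswap : ∫⁻ x in S, ∫⁻ y in B, ∫⁻ t in Ioc (0 : ℝ) 1, F (y + t • (x - y)) =
      ∫⁻ t in Ioc (0 : ℝ) 1, ∫⁻ x in S, ∫⁻ y in B, F (y + t • (x - y)) := by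
    have e1 : ∀ x : Plane, ∫⁻ y in B, ∫⁻ t in Ioc (0 : ℝ) 1, F (y + t • (x - y)) =
        ∫⁻ t in Ioc (0 : ℝ) 1, ∫⁻ y in B, F (y + t • (x - y)) := fun x =>
      lintegral_lintegral_swap (by
        refine Measurable.aemeasurable ?_
        simp only [Function.uncurry_def]
        fun_prop)
    simp only [e1]
    refine lintegral_lintegral_swap (Measurable.aemeasurable ?_)
    refine Measurable.lintegral_prod_right' (f := fun q : (Plane × ℝ) × Plane =>
      F (q.2 + q.1.2 • (q.1.1 - q.2))) ?_
    fun_prop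
  rw [hswap]
  calc _ ≤ ∫⁻ _t in Ioc (0 : ℝ) 1, 4 * (volume S + volume B) * ∫⁻ z, F z := by
        refine lintegral_mono fun t => ?_
        rcases le_total (1 / 2) t with ht | ht
        · refine (lintegral_segment_le_left hF S B ht).trans ?_
          gcongr
          exact le_add_self
        -- For `t ≤ 1 / 2` the segment is read from its other end, with parameter `1 - t ≥ 1 / 2`.
        · have hm' : Measurable fun q : Plane × Plane => F (q.2 + t • (q.1 - q.2)) := by fun_prop
          rw [lintegral_lintegral_swap hm'.aemeasurable]
          have e : ∀ x y : Plane, y + t • (x - y) = x + (1 - t) • (y - x) := fun x y => by module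
          simp only [e]
          refine (lintegral_segment_le_left hF B S (by linarith)).trans ?_
          gcongr
          exact le_self_add
    _ = _ := by simp

/-- Young's inequality for convolution with a probability density. -/
lemma lintegral_sq_convolution_le {ρ g : Plane → ℝ} (hρ : Measurable ρ) (hg : Measurable g)
    (hρ1 : ∫⁻ t, ‖ρ t‖ₑ = 1) :
    ∫⁻ z, ‖(convolution ρ g (ContinuousLinearMap.lsmul ℝ ℝ) volume) z‖ₑ ^ 2 ≤
      ∫⁻ z, ‖g z‖ₑ ^ 2 := by
  calc _ ≤ ∫⁻ z, ∫⁻ t, ‖ρ t‖ₑ * ‖g (z - t)‖ₑ ^ 2 := by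
        refine lintegral_mono fun z => ?_
        have h1 : ‖(convolution ρ g (ContinuousLinearMap.lsmul ℝ ℝ) volume) z‖ₑ ≤
            ∫⁻ t, ‖g (z - t)‖ₑ ∂(volume.withDensity fun t => ‖ρ t‖ₑ) := by
          rw [lintegral_withDensity_eq_lintegral_mul _ (by fun_prop) (by fun_prop)]
          refine (enorm_integral_le_lintegral_enorm _).trans (le_of_eq ?_)
          simp [enorm_mul]
        refine (pow_le_pow_left' h1 2).trans ((sq_lintegral_le (by fun_prop)).trans ?_)
        rw [withDensity_apply _ MeasurableSet.univ, Measure.restrict_univ, hρ1, one_mul,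
          lintegral_withDensity_eq_lintegral_mul _ (by fun_prop) (by fun_prop)]
        rfl
    _ = ∫⁻ t, ∫⁻ z, ‖ρ t‖ₑ * ‖g (z - t)‖ₑ ^ 2 := by
        refine lintegral_lintegral_swap (Measurable.aemeasurable ?_)
        simp only [Function.uncurry_def]
        fun_prop
    _ = ∫⁻ t, ‖ρ t‖ₑ * ∫⁻ z, ‖g z‖ₑ ^ 2 := by
        refine lintegral_congr fun t => ?_
        rw [lintegral_const_mul _ (by fun_prop),
          lintegral_sub_right_eq_self (fun z => ‖g z‖ₑ ^ 2) t]
    _ = _ := by rw [lintegral_mul_const _ (by fun_prop), hρ1, one_mul]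

/-! ### The Poincaré inequality for smooth functions -/

lemma enorm_fderiv_sq_le (ψ : Plane → ℝ) (z v : Plane) :
    ‖fderiv ℝ ψ z v‖ₑ ^ 2 ≤
      ‖v‖ₑ ^ 2 * (‖partialD 0 ψ z‖ₑ ^ 2 + ‖partialD 1 ψ z‖ₑ ^ 2) := by
  have hv : v = v 0 • EuclideanSpace.single 0 (1 : ℝ) + v 1 • EuclideanSpace.single 1 (1 : ℝ) := by
    ext i; fin_cases i <;> simp
  have h1 : fderiv ℝ ψ z v = v 0 * partialD 0 ψ z + v 1 * partialD 1 ψ z := by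
    conv_lhs => rw [hv]
    simp only [map_add, map_smul, smul_eq_mul, partialD]
  have h2 : ‖v‖ ^ 2 = v 0 ^ 2 + v 1 ^ 2 := by
    rw [EuclideanSpace.norm_sq_eq]; simp
  have h3 : ‖fderiv ℝ ψ z v‖ ^ 2 ≤ ‖v‖ ^ 2 * (‖partialD 0 ψ z‖ ^ 2 + ‖partialD 1 ψ z‖ ^ 2) := by
    rw [h1, h2]
    simp only [Real.norm_eq_abs, sq_abs]
    -- Lagrange's identity: the defect in the planar Cauchy–Schwarz inequality is this square.
    nlinarith [sq_nonneg (v 0 * partialD 1 ψ z - v 1 * partialD 0 ψ z)]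
  simp only [← ofReal_norm]
  rw [← ENNReal.ofReal_pow (norm_nonneg _), ← ENNReal.ofReal_pow (norm_nonneg _),
    ← ENNReal.ofReal_pow (norm_nonneg _), ← ENNReal.ofReal_pow (norm_nonneg _),
    ← ENNReal.ofReal_add (by positivity) (by positivity), ← ENNReal.ofReal_mul (by positivity)]
  exact ENNReal.ofReal_le_ofReal h3

lemma continuous_partialD {ψ : Plane → ℝ} (hψ : ContDiff ℝ 1 ψ) (i : Fin 2) :
    Continuous (partialD i ψ) :=
  (hψ.continuous_fderiv one_ne_zero).clm_apply continuous_const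

/-- The mean value theorem in integrated form. -/
lemma enorm_sub_sq_le_lintegral {ψ : Plane → ℝ} (hψ : ContDiff ℝ 1 ψ) (x y : Plane) :
    ‖ψ x - ψ y‖ₑ ^ 2 ≤ ‖x - y‖ₑ ^ 2 * ∫⁻ t in Ioc (0 : ℝ) 1,
      (‖partialD 0 ψ (y + t • (x - y))‖ₑ ^ 2 + ‖partialD 1 ψ (y + t • (x - y))‖ₑ ^ 2) := by
  have hd : ∀ t : ℝ, HasDerivAt (fun t : ℝ => ψ (y + t • (x - y)))
      (fderiv ℝ ψ (y + t • (x - y)) (x - y)) t := fun t => by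
    have h1 : HasDerivAt (fun t : ℝ => y + t • (x - y)) (x - y) t := by
      simpa using ((hasDerivAt_id t).smul_const (x - y)).const_add y
    exact ((hψ.differentiable one_ne_zero _).hasFDerivAt).comp_hasDerivAt t h1
  have hc : Continuous fun t : ℝ => fderiv ℝ ψ (y + t • (x - y)) (x - y) :=
    ((hψ.continuous_fderiv one_ne_zero).comp (by fun_prop)).clm_apply continuous_const
  have hftc := intervalIntegral.integral_eq_sub_of_hasDerivAt (a := 0) (b := 1)
    (fun t _ => hd t) (hc.intervalIntegrable _ _)
  have e : ψ x - ψ y = ∫ t in Ioc (0 : ℝ) 1, fderiv ℝ ψ (y + t • (x - y)) (x - y) := by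
    rw [← intervalIntegral.integral_of_le zero_le_one, hftc]; simp
  calc ‖ψ x - ψ y‖ₑ ^ 2
      ≤ (∫⁻ t in Ioc (0 : ℝ) 1, ‖fderiv ℝ ψ (y + t • (x - y)) (x - y)‖ₑ) ^ 2 := by
        rw [e]; exact pow_le_pow_left' (enorm_integral_le_lintegral_enorm _) 2
    _ ≤ ∫⁻ t in Ioc (0 : ℝ) 1, ‖fderiv ℝ ψ (y + t • (x - y)) (x - y)‖ₑ ^ 2 := by
        refine (sq_lintegral_le (by fun_prop)).trans ?_
        simp
    _ ≤ ∫⁻ t in Ioc (0 : ℝ) 1, ‖x - y‖ₑ ^ 2 *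
          (‖partialD 0 ψ (y + t • (x - y))‖ₑ ^ 2 + ‖partialD 1 ψ (y + t • (x - y))‖ₑ ^ 2) :=
        lintegral_mono fun t => enorm_fderiv_sq_le ψ _ _
    _ = _ := by
        have := continuous_partialD hψ
        have h0 := (this 0).measurable
        have h1 := (this 1).measurable
        rw [lintegral_const_mul _ (by fun_prop)]

/-- As all segments stay in `S`, the squared gradient may be cut off to zero outside `S` before
averaging over the whole plane; only its integral over `S` then remains. -/
lemma lintegral_sub_sq_le_of_contDiff {ψ : Plane → ℝ} (hψ : ContDiff ℝ 1 ψ) {S B : Set Plane}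
    (hS : MeasurableSet S) (hB : MeasurableSet B)
    (hseg : ∀ x ∈ S, ∀ y ∈ B, ∀ t ∈ Ioc (0 : ℝ) 1, y + t • (x - y) ∈ S) {h : ℝ≥0∞}
    (hh : ∀ x ∈ S, ∀ y ∈ B, ‖x - y‖ₑ ≤ h) :
    ∫⁻ x in S, ∫⁻ y in B, ‖ψ x - ψ y‖ₑ ^ 2 ≤ 4 * h ^ 2 * (volume S + volume B) *
      ∫⁻ z in S, (‖partialD 0 ψ z‖ₑ ^ 2 + ‖partialD 1 ψ z‖ₑ ^ 2) := by
  have h0 := (continuous_partialD hψ 0).measurable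
  have h1 := (continuous_partialD hψ 1).measurable
  set F : Plane → ℝ≥0∞ :=
    S.indicator fun z => ‖partialD 0 ψ z‖ₑ ^ 2 + ‖partialD 1 ψ z‖ₑ ^ 2 with hFdef
  have hF : Measurable F := Measurable.indicator (by fun_prop) hS
  calc _ ≤ ∫⁻ x in S, ∫⁻ y in B, h ^ 2 * ∫⁻ t in Ioc (0 : ℝ) 1, F (y + t • (x - y)) := by
        refine setLIntegral_mono' hS fun x hx => setLIntegral_mono' hB fun y hy => ?_
        refine (enorm_sub_sq_le_lintegral hψ x y).trans ?_
        refine mul_le_mul' (pow_le_pow_left' (hh x hx y hy) 2) ?_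
        refine setLIntegral_mono' measurableSet_Ioc fun t ht => ?_
        rw [hFdef, indicator_of_mem (hseg x hx y hy t ht)]
    _ = h ^ 2 * ∫⁻ x in S, ∫⁻ y in B, ∫⁻ t in Ioc (0 : ℝ) 1, F (y + t • (x - y)) := by
        have m1 : Measurable fun q : Plane × Plane =>
            ∫⁻ t in Ioc (0 : ℝ) 1, F (q.2 + t • (q.1 - q.2)) :=
          Measurable.lintegral_prod_right' (f := fun q : (Plane × Plane) × ℝ =>
            F (q.1.2 + q.2 • (q.1.1 - q.1.2))) (by fun_prop)
        have m2 : ∀ x, Measurable fun y : Plane =>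
            ∫⁻ t in Ioc (0 : ℝ) 1, F (y + t • (x - y)) := fun x =>
          m1.comp (measurable_const.prodMk measurable_id)
        have m3 : Measurable fun x : Plane =>
            ∫⁻ y in B, ∫⁻ t in Ioc (0 : ℝ) 1, F (y + t • (x - y)) :=
          m1.lintegral_prod_right'
        rw [← lintegral_const_mul _ m3]
        refine lintegral_congr fun x => ?_
        rw [lintegral_const_mul _ (m2 x)]
    _ ≤ h ^ 2 * (4 * (volume S + volume B) * ∫⁻ z, F z) := by
        gcongr; exact lintegral_segment_le hF S B
    _ = _ := by rw [hFdef, lintegral_indicator hS]; ring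

/-! ### The Poincaré inequality for weakly differentiable functions -/

lemma classicalD_unitIndex (i : Fin 2) (φ : Plane → ℝ) :
    classicalD (unitIndex i) φ = partialD i φ := by
  fin_cases i <;> simp [classicalD, unitIndex]

lemma unitIndex_sum (i : Fin 2) : (unitIndex i).1 + (unitIndex i).2 = 1 := by
  fin_cases i <;> simp [unitIndex]

lemma IsWeakDeriv.integral_mul_partialD {U : Set Plane} {i : Fin 2} {w g : Plane → ℝ}
    (h : IsWeakDeriv U (unitIndex i) w g) {φ : Plane → ℝ} (hφ : IsTestFunction U φ) :
    ∫ x in U, w x * partialD i φ x = -∫ x in U, g x * φ x := by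
  have := h.2 φ hφ
  rwa [classicalD_unitIndex, unitIndex_sum, pow_one, neg_one_mul] at this

lemma partialD_const_sub (i : Fin 2) {ρ : Plane → ℝ} (hρ : Differentiable ℝ ρ) (z y : Plane) :
    partialD i (fun y => ρ (z - y)) y = -partialD i ρ (z - y) := by
  have h1 := (hρ (z - y)).hasFDerivAt.comp y ((hasFDerivAt_id (𝕜 := ℝ) y).const_sub z)
  have h2 : fderiv ℝ (fun y => ρ (z - y)) y = _ := h1.fderiv
  simp [partialD, h2]

lemma integrable_indicator_of_memLp {K : Set Plane} (hK : IsOpen K)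
    (hb : Bornology.IsBounded K) {w : Plane → ℝ} (hw : MemLp w 2 (volume.restrict K)) :
    Integrable (K.indicator w) := by
  have : IsFiniteMeasure (volume.restrict K) := ⟨by simpa using hb.measure_lt_top⟩
  exact (integrable_indicator_iff hK.measurableSet).2 (hw.integrable one_le_two)

/-- Mollification commutes with weak differentiation away from the boundary. -/
lemma partialD_convolution {K : Set Plane} (hK : IsOpen K) (hb : Bornology.IsBounded K)
    {w g : Plane → ℝ} (hw : MemLp w 2 (volume.restrict K)) {i : Fin 2}
    (hg : IsWeakDeriv K (unitIndex i) w g) (ρ : ContDiffBump (0 : Plane)) {z : Plane}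
    (hz : Metric.closedBall z ρ.rOut ⊆ K) :
    partialD i (convolution (ρ.normed volume) (K.indicator w)
      (ContinuousLinearMap.lsmul ℝ ℝ) volume) z =
    convolution (ρ.normed volume) (K.indicator g) (ContinuousLinearMap.lsmul ℝ ℝ) volume z := by
  set η : Plane → ℝ := ρ.normed volume with hη
  have hηs : ContDiff ℝ ∞ η := ρ.contDiff_normed
  have hη1 : ContDiff ℝ 1 η := ρ.contDiff_normed
  have hηc : HasCompactSupport η := ρ.hasCompactSupport_normed
  have hW := (integrable_indicator_of_memLp hK hb hw).locallyIntegrable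
  -- The reflected bump centred at `z` is admissible in the definition of the weak derivative
  -- because its support lies in the ball contained in `K`.
  have hφ : IsTestFunction K fun y => η (z - y) := by
    have hsupp : tsupport (fun y => η (z - y)) ⊆ Metric.closedBall z ρ.rOut := by
      refine closure_minimal (fun y hy => ?_) Metric.isClosed_closedBall
      have : z - y ∈ Function.support (ρ.normed volume) := hy
      rw [ρ.support_normed_eq] at this
      simpa [dist_eq_norm, norm_sub_rev] using (le_of_lt (by simpa using this) : ‖z - y‖ ≤ ρ.rOut)
    exact ⟨by fun_prop, HasCompactSupport.of_support_subset_isCompact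
      (isCompact_closedBall z ρ.rOut) ((subset_tsupport _).trans hsupp), hsupp.trans hz⟩
  have hfd := (hηc.hasFDerivAt_convolution_left (ContinuousLinearMap.lsmul ℝ ℝ) hη1 hW z).fderiv
  have hint := (hηc.fderiv (𝕜 := ℝ)).convolutionExists_left
    ((ContinuousLinearMap.lsmul ℝ ℝ).precompL Plane) (hη1.continuous_fderiv one_ne_zero) hW z
  rw [partialD, hfd, convolution_def, ContinuousLinearMap.integral_apply hint]
  have e1 : ∀ t : Plane, ((ContinuousLinearMap.lsmul ℝ ℝ).precompL Plane (fderiv ℝ η t)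
      (K.indicator w (z - t))) (EuclideanSpace.single i 1) =
      partialD i η t * K.indicator w (z - t) := fun t => by
    simp [partialD, ContinuousLinearMap.precompL_apply]
  simp only [e1]
  -- After `t ↦ z - t` the derivative falls on the test function `y ↦ η (z - y)`. The sign from the
  -- reflection cancels the one from integration by parts.
  rw [← integral_sub_left_eq_self _ _ z]
  simp only [sub_sub_cancel]
  rw [convolution_eq_swap]
  have e2 : ∀ y, partialD i η (z - y) * K.indicator w y =
      K.indicator (fun y => -(w y * partialD i (fun y => η (z - y)) y)) y := fun y => by
    by_cases hy : y ∈ K <;> simp [hy, partialD_const_sub i (hη1.differentiable one_ne_zero), mul_comm]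
  have e3 : ∀ y, (ContinuousLinearMap.lsmul ℝ ℝ) (η (z - y)) (K.indicator g y) =
      K.indicator (fun y => g y * η (z - y)) y := fun y => by
    by_cases hy : y ∈ K <;> simp [hy, mul_comm]
  simp only [e2, e3]
  rw [integral_indicator hK.measurableSet, integral_indicator hK.measurableSet, integral_neg,
    hg.integral_mul_partialD hφ, neg_neg]

/-- The image of `K` under the homothety with centre `c` and ratio `s`. -/
def shrink (c : Plane) (s : ℝ) (K : Set Plane) : Set Plane :=
  (fun x => c + s⁻¹ • (x - c)) ⁻¹' K

/-- If `x = c + s • (x' - c)` with `x' ∈ K`, then `y = s • x' + (1 - s) • (c + (1 - s)⁻¹ • (y -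
x))`, a convex combination of `x'` and a point of the ball. This gives room for mollification; the
factor `1 / 2` keeps that point strictly inside the open ball. -/
lemma closedBall_subset_of_mem_shrink {K : Set Plane} {c : Plane} {R s : ℝ}
    (hs : 0 < s) (hs1 : s < 1) (hR : 0 < R)
    (hstar : ∀ z ∈ Metric.ball c R, StarConvex ℝ z K) {x : Plane} (hx : x ∈ shrink c s K) :
    Metric.closedBall x ((1 - s) * R / 2) ⊆ K := by
  intro y hy
  have h1 : 0 < 1 - s := by linarith
  have hmem : c + (1 - s)⁻¹ • (y - x) ∈ Metric.ball c R := by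
    rw [Metric.mem_closedBall, dist_eq_norm] at hy
    rw [Metric.mem_ball, dist_eq_norm, add_sub_cancel_left, norm_smul, Real.norm_eq_abs,
      abs_of_pos (inv_pos.2 h1), inv_mul_lt_iff₀ h1]
    nlinarith
  have := hstar _ hmem hx h1.le hs.le (by ring)
  convert this using 1
  simp only [smul_add, smul_inv_smul₀ h1.ne', smul_inv_smul₀ hs.ne']
  module

/-- The homothety carries the segment to one joining a point of the original ball to a point of `K`;
hence the ball is scaled by `s` too. -/
lemma segment_mem_shrink {K : Set Plane} {c : Plane} {R s : ℝ} (hs : 0 < s)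
    (hstar : ∀ z ∈ Metric.ball c R, StarConvex ℝ z K) {x y : Plane} (hx : x ∈ shrink c s K)
    (hy : y ∈ Metric.ball c (s * R)) {t : ℝ} (ht : t ∈ Ioc (0 : ℝ) 1) :
    y + t • (x - y) ∈ shrink c s K := by
  have hmem : c + s⁻¹ • (y - c) ∈ Metric.ball c R := by
    rw [Metric.mem_ball, dist_eq_norm] at hy ⊢
    rwa [add_sub_cancel_left, norm_smul, Real.norm_eq_abs, abs_of_pos (inv_pos.2 hs),
      inv_mul_lt_iff₀ hs]
  have := hstar _ hmem hx (sub_nonneg.2 ht.2) ht.1.le (by ring)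
  change c + s⁻¹ • (y + t • (x - y) - c) ∈ K
  convert this using 1
  module

lemma IsOpen.eventually_mem_shrink {K : Set Plane} (hK : IsOpen K) {c x : Plane} (hx : x ∈ K)
    {s : ℕ → ℝ} (hs : Tendsto s atTop (𝓝 1)) : ∀ᶠ n in atTop, x ∈ shrink c (s n) K := by
  have : Tendsto (fun n => c + (s n)⁻¹ • (x - c)) atTop (𝓝 x) := by
    have h := ((hs.inv₀ one_ne_zero).smul_const (x - c)).const_add c
    simpa using h
  exact this.eventually (hK.mem_nhds hx)

/-- Moves domains that vary with the mollification parameter into the integrand, so that Fatou's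
lemma applies on a fixed domain. -/
lemma lintegral_indicator_prod {S B : Set Plane} (hS : MeasurableSet S) (hB : MeasurableSet B)
    (Φ : Plane → Plane → ℝ≥0∞) :
    ∫⁻ x, ∫⁻ y, (S ×ˢ B).indicator (fun q => Φ q.1 q.2) (x, y) =
      ∫⁻ x in S, ∫⁻ y in B, Φ x y := by
  rw [← lintegral_indicator hS]
  refine lintegral_congr fun x => ?_
  by_cases hx : x ∈ S
  · rw [indicator_of_mem hx, ← lintegral_indicator hB]
    refine lintegral_congr fun y => ?_
    by_cases hy : y ∈ B <;> simp [hx, hy]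
  · simp [hx]

/-- A double integral form of the Poincaré inequality. -/
lemma lintegral_sub_sq_le_of_isWeakDeriv {K : Set Plane} (hK : IsOpen K)
    (hb : Bornology.IsBounded K) (hne : K.Nonempty) {c : Plane} {R : ℝ} (hR : 0 < R)
    (hstar : ∀ z ∈ Metric.ball c R, StarConvex ℝ z K) {h : ℝ≥0∞}
    (hh : ∀ x ∈ K, ∀ y ∈ K, ‖x - y‖ₑ ≤ h) {w : Plane → ℝ} {g : Fin 2 → Plane → ℝ}
    (hw : MemLp w 2 (volume.restrict K)) (hgm : ∀ i, Measurable (g i))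
    (hg : ∀ i, IsWeakDeriv K (unitIndex i) w (g i)) :
    ∫⁻ x in K, ∫⁻ y in Metric.ball c R, ‖w x - w y‖ₑ ^ 2 ≤
      4 * h ^ 2 * (volume K + volume (Metric.ball c R)) *
        ((∫⁻ z in K, ‖g 0 z‖ₑ ^ 2) + ∫⁻ z in K, ‖g 1 z‖ₑ ^ 2) := by
  have hBK : Metric.ball c R ⊆ K := fun z hz => by
    obtain ⟨x, hx⟩ := hne
    simpa using hstar z hz hx zero_le_one le_rfl (by simp)
  have hW := integrable_indicator_of_memLp hK hb hw
  -- The shift by 2 keeps every ratio strictly between 0 and 1.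
  set s : ℕ → ℝ := fun n => 1 - 1 / ((n : ℝ) + 2) with hsdef
  have hpos : ∀ n : ℕ, 0 < 1 / ((n : ℝ) + 2) := fun n => by positivity
  have hs0 : ∀ n, 0 < s n := fun n => by
    have : 1 / ((n : ℝ) + 2) < 1 := by
      rw [div_lt_one (by positivity)]; linarith [Nat.cast_nonneg (α := ℝ) n]
    simp only [hsdef]; linarith
  have hs1 : ∀ n, s n < 1 := fun n => by simp only [hsdef]; linarith [hpos n]
  have hlim : Tendsto (fun n : ℕ => 1 / ((n : ℝ) + 2)) atTop (𝓝 0) :=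
    tendsto_const_nhds.div_atTop (tendsto_natCast_atTop_atTop.atTop_add tendsto_const_nhds)
  have hslim : Tendsto s atTop (𝓝 1) := by
    simpa only [sub_zero] using hlim.const_sub 1
  have hrpos : ∀ n, 0 < (1 - s n) * R / 2 := fun n => by
    have := hs1 n
    have : 0 < 1 - s n := by linarith
    positivity
  -- The outer radius is the one allowed by `closedBall_subset_of_mem_shrink`; its fixed ratio 2 to
  -- the inner radius yields almost everywhere convergence of the mollifications.
  let ρ : ℕ → ContDiffBump (0 : Plane) := fun n =>
    ⟨(1 - s n) * R / 2 / 2, (1 - s n) * R / 2, by linarith [hrpos n], by linarith [hrpos n]⟩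
  set ψ : ℕ → Plane → ℝ := fun n => convolution ((ρ n).normed volume) (K.indicator w)
    (ContinuousLinearMap.lsmul ℝ ℝ) volume with hψdef
  have hψ : ∀ n, ContDiff ℝ 1 (ψ n) := fun n =>
    (ρ n).hasCompactSupport_normed.contDiff_convolution_left _ (n := 1)
      (ρ n).contDiff_normed hW.locallyIntegrable
  have hconv : ∀ᵐ x, Tendsto (fun n => ψ n x) atTop (𝓝 (K.indicator w x)) := by
    refine ContDiffBump.ae_convolution_tendsto_right_of_locallyIntegrable (K := 2) ?_ ?_
      hW.locallyIntegrable
    · have := ((hslim.const_sub 1).mul_const R).div_const 2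
      simpa using this
    · refine Eventually.of_forall fun n => ?_
      simp only [ρ]; linarith
  set S : ℕ → Set Plane := fun n => shrink c (s n) K with hSdef
  set B : ℕ → Set Plane := fun n => Metric.ball c (s n * R) with hBdef
  have hSm : ∀ n, MeasurableSet (S n) := fun n =>
    (hK.preimage (by fun_prop)).measurableSet
  have hBm : ∀ n, MeasurableSet (B n) := fun n => measurableSet_ball
  have hSK : ∀ n, S n ⊆ K := fun n x hx =>
    closedBall_subset_of_mem_shrink (hs0 n) (hs1 n) hR hstar hx
      (Metric.mem_closedBall_self (hrpos n).le)
  have hBB : ∀ n, B n ⊆ Metric.ball c R := fun n =>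
    Metric.ball_subset_ball (by nlinarith [hs1 n])
  let Φ : ℕ → Plane → Plane → ℝ≥0∞ := fun n x y =>
    (S n ×ˢ B n).indicator (fun q => ‖ψ n q.1 - ψ n q.2‖ₑ ^ 2) (x, y)
  have hΦm : ∀ n, Measurable (Function.uncurry (Φ n)) := fun n => by
    have := (hψ n).continuous.measurable
    exact Measurable.indicator (by fun_prop) ((hSm n).prod (hBm n))
  have hbound : ∀ n, ∫⁻ x in K, ∫⁻ y in Metric.ball c R, Φ n x y ≤
      4 * h ^ 2 * (volume K + volume (Metric.ball c R)) *
        ((∫⁻ z in K, ‖g 0 z‖ₑ ^ 2) + ∫⁻ z in K, ‖g 1 z‖ₑ ^ 2) := fun n => by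
    calc _ ≤ ∫⁻ x, ∫⁻ y, Φ n x y :=
          (setLIntegral_le_lintegral _ _).trans
            (lintegral_mono fun x => setLIntegral_le_lintegral _ _)
      _ = ∫⁻ x in S n, ∫⁻ y in B n, ‖ψ n x - ψ n y‖ₑ ^ 2 :=
          lintegral_indicator_prod (hSm n) (hBm n) fun x y => ‖ψ n x - ψ n y‖ₑ ^ 2
      _ ≤ 4 * h ^ 2 * (volume (S n) + volume (B n)) *
          ∫⁻ z in S n, (‖partialD 0 (ψ n) z‖ₑ ^ 2 + ‖partialD 1 (ψ n) z‖ₑ ^ 2) :=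
          lintegral_sub_sq_le_of_contDiff (hψ n) (hSm n) (hBm n)
            (fun x hx y hy t ht => segment_mem_shrink (hs0 n) hstar hx hy ht)
            (fun x hx y hy => hh x (hSK n hx) y (hBK (hBB n hy)))
      _ ≤ _ := by
          gcongr
          · exact hSK n
          · exact hBB n
          -- On `S n` the derivative of the mollification is the mollification of the weak
          -- derivative, so Young's inequality bounds it uniformly in `n`.
          · have hp : ∀ i, ∫⁻ z in S n, ‖partialD i (ψ n) z‖ₑ ^ 2 ≤
                ∫⁻ z in K, ‖g i z‖ₑ ^ 2 := fun i => by
              calc _ = ∫⁻ z in S n, ‖convolution ((ρ n).normed volume) (K.indicator (g i))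
                    (ContinuousLinearMap.lsmul ℝ ℝ) volume z‖ₑ ^ 2 := by
                    refine setLIntegral_congr_fun (hSm n) fun z hz => ?_
                    simp only [hψdef]
                    rw [partialD_convolution hK hb hw (hg i) (ρ n)
                      (closedBall_subset_of_mem_shrink (hs0 n) (hs1 n) hR hstar hz)]
                _ ≤ _ := setLIntegral_le_lintegral _ _
                _ ≤ ∫⁻ z, ‖K.indicator (g i) z‖ₑ ^ 2 := by
                    refine lintegral_sq_convolution_le (ρ n).continuous_normed.measurable
                      ((hgm i).indicator hK.measurableSet) ?_
                    have h1 := ofReal_integral_eq_lintegral_ofReal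
                      ((ρ n).integrable_normed (μ := volume))
                      (Eventually.of_forall (ρ n).nonneg_normed)
                    rw [(ρ n).integral_normed, ENNReal.ofReal_one] at h1
                    rw [h1]
                    exact lintegral_congr fun t =>
                      Real.enorm_of_nonneg ((ρ n).nonneg_normed t)
                _ = _ := by
                    rw [← lintegral_indicator hK.measurableSet]
                    refine lintegral_congr fun z => ?_
                    by_cases hz : z ∈ K <;> simp [hz]
            have := (continuous_partialD (hψ n) 0).measurable
            rw [lintegral_add_left (by fun_prop)]
            exact add_le_add (hp 0) (hp 1)
  have hpt : ∀ x ∈ K, Tendsto (fun n => ψ n x) atTop (𝓝 (K.indicator w x)) →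
      ∀ y ∈ Metric.ball c R, Tendsto (fun n => ψ n y) atTop (𝓝 (K.indicator w y)) →
      ‖w x - w y‖ₑ ^ 2 ≤ liminf (fun n => Φ n x y) atTop := by
    intro x hx hxl y hy hyl
    rw [indicator_of_mem hx] at hxl
    rw [indicator_of_mem (hBK hy)] at hyl
    refine le_of_eq (Eq.symm (Tendsto.liminf_eq ?_))
    have h1 : Tendsto (fun n => ‖ψ n x - ψ n y‖ₑ ^ 2) atTop (𝓝 (‖w x - w y‖ₑ ^ 2)) :=
      ((ENNReal.continuous_pow 2).tendsto _).comp
        ((continuous_enorm.tendsto _).comp (hxl.sub hyl))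
    refine h1.congr' ?_
    have h2 : ∀ᶠ n in atTop, y ∈ B n := by
      have : Tendsto (fun n => s n * R) atTop (𝓝 R) := by simpa using hslim.mul_const R
      exact this.eventually (lt_mem_nhds (Metric.mem_ball.1 hy))
    filter_upwards [IsOpen.eventually_mem_shrink hK (c := c) hx hslim, h2] with n hn1 hn2
    have : (x, y) ∈ S n ×ˢ B n := ⟨hn1, hn2⟩
    simp only [Φ, indicator_of_mem this]
  have hΦm' : ∀ n x, Measurable (Φ n x) := fun n x => (hΦm n).of_uncurry_left
  clear_value Φ
  -- Fatou's lemma is used twice: here in `y` for almost every `x`, then in `x`.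
  have hin : ∀ᵐ x ∂(volume.restrict K), ∫⁻ y in Metric.ball c R, ‖w x - w y‖ₑ ^ 2 ≤
      liminf (fun n => ∫⁻ y in Metric.ball c R, Φ n x y) atTop := by
    filter_upwards [ae_restrict_of_ae hconv, ae_restrict_mem hK.measurableSet] with x hxl hx
    refine (lintegral_mono_ae ?_).trans
      (lintegral_liminf_le fun n => hΦm' n x)
    filter_upwards [ae_restrict_of_ae hconv, ae_restrict_mem measurableSet_ball] with y hyl hy
    exact hpt x hx hxl y hy hyl
  refine (lintegral_mono_ae hin).trans ((lintegral_liminf_le fun n =>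
    Measurable.lintegral_prod_right' (hΦm n)).trans ?_)
  refine (liminf_le_liminf (Eventually.of_forall hbound)).trans ?_
  rw [liminf_const]

/-- The Poincaré inequality on a domain which is star-shaped with respect to a ball. -/
lemma exists_const_lintegral_sub_sq_le {K : Set Plane} (hK : IsOpen K)
    (hb : Bornology.IsBounded K) (hne : K.Nonempty) {c : Plane} {γ h : ℝ} (hγ : 0 < γ)
    (hh0 : 0 < h) (hstar : ∀ z ∈ Metric.ball c (γ * h), StarConvex ℝ z K)
    (hh : ∀ x ∈ K, ∀ y ∈ K, dist x y ≤ h) {w : Plane → ℝ} {g : Fin 2 → Plane → ℝ}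
    (hw : MemLp w 2 (volume.restrict K)) (hg : ∀ i, IsWeakDeriv K (unitIndex i) w (g i)) :
    ∃ a : ℝ, ∫⁻ x in K, ‖w x - a‖ₑ ^ 2 ≤ ENNReal.ofReal (4 * h ^ 2 * ((γ ^ 2)⁻¹ + 1)) *
        ((∫⁻ z in K, ‖g 0 z‖ₑ ^ 2) + ∫⁻ z in K, ‖g 1 z‖ₑ ^ 2) := by
  have hR : 0 < γ * h := by positivity
  set D := Metric.ball c (γ * h) with hD
  have hBK : D ⊆ K := fun z hz => by
    obtain ⟨x, hx⟩ := hne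
    simpa using hstar z hz hx zero_le_one le_rfl (by simp)
  have hcK : c ∈ K := hBK (Metric.mem_ball_self hR)
  have hDpos : volume D ≠ 0 := (Metric.measure_ball_pos _ _ hR).ne'
  have hDtop : volume D ≠ ⊤ := measure_ball_lt_top.ne
  have : IsFiniteMeasure (volume.restrict D) := ⟨by simpa using hDtop.lt_top⟩
  have hwD : Integrable w (volume.restrict D) :=
    (hw.mono_measure (Measure.restrict_mono hBK le_rfl)).integrable one_le_two
  -- replace the weak derivatives by measurable representatives
  let g' : Fin 2 → Plane → ℝ := fun i => (hg i).1.1.mk (g i)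
  have hgg' : ∀ i, g i =ᵐ[volume.restrict K] g' i := fun i => (hg i).1.1.ae_eq_mk
  have hg'm : ∀ i, Measurable (g' i) := fun i => (hg i).1.1.stronglyMeasurable_mk.measurable
  have hg' : ∀ i, IsWeakDeriv K (unitIndex i) w (g' i) := fun i =>
    ⟨(memLp_congr_ae (hgg' i)).1 (hg i).1, fun φ hφ => by
      rw [(hg i).2 φ hφ]
      congr 1
      refine integral_congr_ae ?_
      filter_upwards [hgg' i] with x hx
      rw [hx]⟩
  have hgl : ∀ i, ∫⁻ z in K, ‖g i z‖ₑ ^ 2 = ∫⁻ z in K, ‖g' i z‖ₑ ^ 2 := fun i => by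
    refine lintegral_congr_ae ?_
    filter_upwards [hgg' i] with x hx
    rw [hx]
  have hmain := lintegral_sub_sq_le_of_isWeakDeriv hK hb hne hR hstar
    (h := ENNReal.ofReal h) (fun x hx y hy => by
      rw [← ofReal_norm, ← dist_eq_norm]
      exact ENNReal.ofReal_le_ofReal (hh x hx y hy)) hw hg'm hg'
  rw [← hgl, ← hgl] at hmain
  -- `K` lies in the ball of radius `h` about `c`, while `D` has radius `γ * h`; this area ratio
  -- brings `γ` into the constant.
  have hvol : volume K ≤ ENNReal.ofReal ((γ ^ 2)⁻¹) * volume D := by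
    have h1 : K ⊆ Metric.closedBall c h := fun x hx => hh x hx c hcK
    refine (measure_mono h1).trans (le_of_eq ?_)
    rw [hD, Measure.addHaar_closedBall _ _ hh0.le, Measure.addHaar_ball _ _ hR.le, ← mul_assoc,
      ← ENNReal.ofReal_mul (by positivity), finrank_euclideanSpace_fin]
    congr 2
    field_simp
  set a : ℝ := ⨍ y in D, w y with ha
  refine ⟨a, ?_⟩
  -- `w x - a` is the mean of `w x - w y` over `y ∈ D`, so its square is at most the mean square.
  have hpt : ∀ x, ‖w x - a‖ₑ ^ 2 ≤ (volume D)⁻¹ * ∫⁻ y in D, ‖w x - w y‖ₑ ^ 2 := by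
    intro x
    have e : volume.real D * (w x - a) = ∫ y in D, (w x - w y) := by
      have hne : volume.real D ≠ 0 := (ENNReal.toReal_pos hDpos hDtop).ne'
      rw [integral_sub (integrable_const _) hwD, ha, setAverage_eq]
      simp only [integral_const, smul_eq_mul, measureReal_restrict_apply_univ]
      field_simp
    have h2 : volume D ^ 2 * ‖w x - a‖ₑ ^ 2 ≤ volume D * ∫⁻ y in D, ‖w x - w y‖ₑ ^ 2 := by
      have e' : volume D * ‖w x - a‖ₑ = ‖∫ y in D, (w x - w y)‖ₑ := by
        rw [← e, enorm_mul, Real.enorm_of_nonneg measureReal_nonneg, Measure.real,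
          ENNReal.ofReal_toReal hDtop]
      rw [← mul_pow, e']
      refine (pow_le_pow_left' (enorm_integral_le_lintegral_enorm _) 2).trans ?_
      refine (sq_lintegral_le (hwD.1.aemeasurable.const_sub _).enorm).trans ?_
      rw [Measure.restrict_apply_univ]
    rw [sq, mul_assoc, ENNReal.mul_le_mul_iff_right hDpos hDtop] at h2
    calc _ = (volume D)⁻¹ * volume D * ‖w x - a‖ₑ ^ 2 := by
          rw [ENNReal.inv_mul_cancel hDpos hDtop, one_mul]
      _ ≤ _ := by rw [mul_assoc]; gcongr
  calc _ ≤ ∫⁻ x in K, (volume D)⁻¹ * ∫⁻ y in D, ‖w x - w y‖ₑ ^ 2 := lintegral_mono hpt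
    _ = (volume D)⁻¹ * ∫⁻ x in K, ∫⁻ y in D, ‖w x - w y‖ₑ ^ 2 :=
        lintegral_const_mul' _ _ (ENNReal.inv_ne_top.2 hDpos)
    _ ≤ (volume D)⁻¹ * (4 * ENNReal.ofReal h ^ 2 * (volume K + volume D) *
        ((∫⁻ z in K, ‖g 0 z‖ₑ ^ 2) + ∫⁻ z in K, ‖g 1 z‖ₑ ^ 2)) := by gcongr
    _ ≤ (volume D)⁻¹ * (4 * ENNReal.ofReal h ^ 2 *
          (ENNReal.ofReal ((γ ^ 2)⁻¹) * volume D + volume D) *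
        ((∫⁻ z in K, ‖g 0 z‖ₑ ^ 2) + ∫⁻ z in K, ‖g 1 z‖ₑ ^ 2)) := by gcongr
    _ = ((volume D)⁻¹ * volume D) * (4 * ENNReal.ofReal h ^ 2 *
          (ENNReal.ofReal ((γ ^ 2)⁻¹) + 1) *
        ((∫⁻ z in K, ‖g 0 z‖ₑ ^ 2) + ∫⁻ z in K, ‖g 1 z‖ₑ ^ 2)) := by ring
    _ = _ := by
      rw [ENNReal.inv_mul_cancel hDpos hDtop, one_mul, ENNReal.ofReal_mul (by positivity),
        ENNReal.ofReal_mul (by positivity), ENNReal.ofReal_pow hh0.le,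
        ENNReal.ofReal_add (by positivity) zero_le_one, ENNReal.ofReal_one,
        show ENNReal.ofReal 4 = 4 by norm_num]

/-! ### Test functions and weak derivatives -/

lemma contDiff_partialD {φ : Plane → ℝ} (hφ : ContDiff ℝ ∞ φ) (i : Fin 2) :
    ContDiff ℝ ∞ (partialD i φ) :=
  (hφ.fderiv_right (m := ∞) (by simp)).clm_apply contDiff_const

lemma tsupport_partialD_subset (φ : Plane → ℝ) (i : Fin 2) :
    tsupport (partialD i φ) ⊆ tsupport φ :=
  tsupport_fderiv_apply_subset ℝ _

lemma IsTestFunction.partialD {U : Set Plane} {φ : Plane → ℝ} (h : IsTestFunction U φ)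
    (i : Fin 2) : IsTestFunction U (partialD i φ) :=
  ⟨contDiff_partialD h.1 i, h.2.1.mono' ((subset_tsupport _).trans (tsupport_partialD_subset φ i)),
    (tsupport_partialD_subset φ i).trans h.2.2⟩

lemma IsTestFunction.iterate_partialD {U : Set Plane} {φ : Plane → ℝ} (h : IsTestFunction U φ)
    (i : Fin 2) (n : ℕ) : IsTestFunction U ((PolyVEM.partialD i)^[n] φ) := by
  induction n with
  | zero => exact h
  | succ n ih => rw [Function.iterate_succ_apply']; exact ih.partialD i

lemma IsTestFunction.classicalD {U : Set Plane} {φ : Plane → ℝ} (h : IsTestFunction U φ)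
    (ν : ℕ × ℕ) : IsTestFunction U (classicalD ν φ) :=
  (h.iterate_partialD 1 ν.2).iterate_partialD 0 ν.1

lemma IsTestFunction.eq_zero {U : Set Plane} {φ : Plane → ℝ} (h : IsTestFunction U φ) {x : Plane}
    (hx : x ∉ U) : φ x = 0 :=
  image_eq_zero_of_notMem_tsupport fun hx' => hx (h.2.2 hx')

lemma IsTestFunction.mono {U V : Set Plane} (hUV : U ⊆ V) {φ : Plane → ℝ}
    (h : IsTestFunction U φ) : IsTestFunction V φ :=
  ⟨h.1, h.2.1, h.2.2.trans hUV⟩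

lemma partialD_comm {φ : Plane → ℝ} (hφ : ContDiff ℝ ∞ φ) (i j : Fin 2) :
    partialD i (partialD j φ) = partialD j (partialD i φ) := by
  have hd : Differentiable ℝ (fderiv ℝ φ) :=
    (hφ.fderiv_right (m := ∞) (by simp)).differentiable (by simp)
  have key : ∀ (i j : Fin 2) (x : Plane), partialD i (partialD j φ) x =
      fderiv ℝ (fderiv ℝ φ) x (EuclideanSpace.single i 1) (EuclideanSpace.single j 1) := by
    intro i j x
    have h := ((hd x).hasFDerivAt.clm_apply
      (hasFDerivAt_const (EuclideanSpace.single j (1 : ℝ)) x)).fderiv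
    change fderiv ℝ (fun y => fderiv ℝ φ y (EuclideanSpace.single j 1)) x _ = _
    rw [h]
    simp
  ext x
  rw [key, key]
  exact (hφ.contDiffAt.isSymmSndFDerivAt (by simp; exact WithTop.coe_le_coe.2 (le_top (a := (2 : ℕ∞))))) _ _

lemma iterate_partialD_comm {φ : Plane → ℝ} (hφ : ContDiff ℝ ∞ φ) (i j : Fin 2) (n : ℕ) :
    (partialD i)^[n] (partialD j φ) = partialD j ((partialD i)^[n] φ) := by
  induction n generalizing φ with
  | zero => rfl
  | succ n ih =>
    rw [Function.iterate_succ_apply, Function.iterate_succ_apply, partialD_comm hφ,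
      ih (contDiff_partialD hφ i)]

lemma classicalD_partialD {φ : Plane → ℝ} (hφ : ContDiff ℝ ∞ φ) (ν : ℕ × ℕ) (i : Fin 2) :
    classicalD ν (partialD i φ) = classicalD (ν + unitIndex i) φ := by
  obtain ⟨a, b⟩ := ν
  fin_cases i
  · simp [classicalD, unitIndex, iterate_partialD_comm hφ, Function.iterate_succ_apply]
  · simp [classicalD, unitIndex, Function.iterate_succ_apply]

lemma IsWeakDeriv.mono {U V : Set Plane} (hV : IsOpen V) (hUV : U ⊆ V)
    {ν : ℕ × ℕ} {u g : Plane → ℝ} (h : IsWeakDeriv V ν u g) : IsWeakDeriv U ν u g := by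
  refine ⟨h.1.mono_measure (Measure.restrict_mono hUV le_rfl), fun φ hφ => ?_⟩
  have := h.2 φ (hφ.mono hUV)
  rwa [setIntegral_eq_of_subset_of_forall_sdiff_eq_zero hV.measurableSet hUV
      (fun x hx => by rw [(hφ.classicalD ν).eq_zero hx.2, mul_zero]),
    setIntegral_eq_of_subset_of_forall_sdiff_eq_zero hV.measurableSet hUV
      (fun x hx => by rw [hφ.eq_zero hx.2, mul_zero])] at this

/-- Testing the derivative of order `ν` against `∂ᵢφ` gives the derivative of order `ν + unitIndex
i`, up to a sign. Higher derivatives thus become successive first-order ones, to which the Poincaré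
inequality applies. -/
lemma IsWeakDeriv.of_add_unitIndex {U : Set Plane} {ν : ℕ × ℕ} {i : Fin 2} {u g g' : Plane → ℝ}
    (h : IsWeakDeriv U ν u g) (h' : IsWeakDeriv U (ν + unitIndex i) u g') :
    IsWeakDeriv U (unitIndex i) g g' := by
  refine ⟨h'.1, fun φ hφ => ?_⟩
  have e1 := h.2 _ (hφ.partialD i)
  have e2 := h'.2 φ hφ
  rw [classicalD_partialD hφ.1] at e1
  rw [e1] at e2
  have e3 : (ν + unitIndex i).1 + (ν + unitIndex i).2 = ν.1 + ν.2 + 1 := by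
    have := unitIndex_sum i
    simp only [Prod.fst_add, Prod.snd_add]
    omega
  rw [classicalD_unitIndex, unitIndex_sum]
  rw [e3, pow_succ, mul_assoc] at e2
  simpa using mul_left_cancel₀ (pow_ne_zero _ (by norm_num)) e2

lemma IsWeakDeriv.sub {U : Set Plane} {ν : ℕ × ℕ}
    {u u' g g' : Plane → ℝ} (hu : MemLp u 2 (volume.restrict U))
    (hu' : MemLp u' 2 (volume.restrict U)) (h : IsWeakDeriv U ν u g)
    (h' : IsWeakDeriv U ν u' g') : IsWeakDeriv U ν (u - u') (g - g') := by
  refine ⟨h.1.sub h'.1, fun φ hφ => ?_⟩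
  have hL : ∀ {φ : Plane → ℝ}, IsTestFunction U φ → MemLp φ 2 (volume.restrict U) := fun hφ =>
    (hφ.1.continuous.memLp_of_hasCompactSupport hφ.2.1).restrict _
  have hi : ∀ {a φ : Plane → ℝ}, MemLp a 2 (volume.restrict U) → IsTestFunction U φ →
      Integrable (fun x => a x * φ x) (volume.restrict U) := fun ha hφ =>
    MemLp.integrable_mul ha (hL hφ)
  simp only [Pi.sub_apply, sub_mul]
  rw [integral_sub (hi hu (hφ.classicalD ν)) (hi hu' (hφ.classicalD ν)),
    integral_sub (hi h.1 hφ) (hi h'.1 hφ), h.2 φ hφ, h'.2 φ hφ, mul_sub]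

/-! ### Polynomials -/

open MvPolynomial in
lemma hasFDerivAt_polyFun (q : MvPolynomial (Fin 2) ℝ) (x : Plane) :
    HasFDerivAt (polyFun q) (polyFun (pderiv 0 q) x • EuclideanSpace.proj (𝕜 := ℝ) 0 +
      polyFun (pderiv 1 q) x • EuclideanSpace.proj (𝕜 := ℝ) (1 : Fin 2)) x := by
  induction q using MvPolynomial.induction_on with
  | C a =>
    have : polyFun (C a) = fun _ => a := by ext; simp [polyFun]
    rw [this]
    simpa [polyFun] using hasFDerivAt_const a x
  | add p q hp hq =>
    have : polyFun (p + q) = polyFun p + polyFun q := by ext; simp [polyFun]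
    rw [this]
    refine (hp.add hq).congr_fderiv ?_
    ext v
    simp [polyFun]
    ring
  | mul_X p i hp =>
    have : polyFun (p * X i) = polyFun p * fun y : Plane => y i := by ext; simp [polyFun]
    rw [this]
    have hi : HasFDerivAt (fun y : Plane => y i) (EuclideanSpace.proj (𝕜 := ℝ) i) x :=
      (EuclideanSpace.proj (𝕜 := ℝ) i).hasFDerivAt
    refine (hp.mul hi).congr_fderiv ?_
    ext v
    fin_cases i <;> simp [polyFun, pderiv_X] <;> ring

lemma partialD_polyFun (i : Fin 2) (q : MvPolynomial (Fin 2) ℝ) :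
    partialD i (polyFun q) = polyFun (MvPolynomial.pderiv i q) := by
  ext x
  rw [partialD, (hasFDerivAt_polyFun q x).fderiv]
  fin_cases i <;> simp

lemma isWeakDeriv_polyFun {U : Set Plane} (hb : Bornology.IsBounded U) (i : Fin 2)
    (q : MvPolynomial (Fin 2) ℝ) :
    IsWeakDeriv U (unitIndex i) (polyFun q) (polyFun (MvPolynomial.pderiv i q)) := by
  refine ⟨memLp_polyFun hb _, fun φ hφ => ?_⟩
  rw [classicalD_unitIndex, unitIndex_sum, pow_one, neg_one_mul]
  have hfull : ∀ (p : MvPolynomial (Fin 2) ℝ) {ψ : Plane → ℝ}, IsTestFunction U ψ →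
      ∫ x in U, polyFun p x * ψ x = ∫ x, polyFun p x * ψ x := fun p ψ hψ =>
    setIntegral_eq_integral_of_forall_compl_eq_zero fun x hx => by rw [hψ.eq_zero hx, mul_zero]
  have hint : ∀ (p : MvPolynomial (Fin 2) ℝ) {ψ : Plane → ℝ}, IsTestFunction U ψ →
      Integrable fun x => polyFun p x * ψ x := fun p ψ hψ =>
    ((continuous_polyFun p).mul hψ.1.continuous).integrable_of_hasCompactSupport
      hψ.2.1.mul_left
  rw [hfull _ (hφ.partialD i), hfull _ hφ, ← partialD_polyFun]
  refine integral_mul_fderiv_eq_neg_fderiv_mul_of_integrable ?_ (hint q (hφ.partialD i))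
    (hint q hφ) (fun x _ => (hasFDerivAt_polyFun q x).differentiableAt)
    (fun x _ => hφ.1.differentiable (by simp) x)
  have := hint (MvPolynomial.pderiv i q) hφ
  rwa [← partialD_polyFun] at this

/-- The formal derivative `D^ν` of a polynomial. -/
noncomputable def polyD (ν : ℕ × ℕ) (q : MvPolynomial (Fin 2) ℝ) : MvPolynomial (Fin 2) ℝ :=
  (MvPolynomial.pderiv 0)^[ν.1] ((MvPolynomial.pderiv 1)^[ν.2] q)

lemma pderiv_polyD (ν : ℕ × ℕ) (i : Fin 2) (q : MvPolynomial (Fin 2) ℝ) :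
    MvPolynomial.pderiv i (polyD ν q) = polyD (ν + unitIndex i) q := by
  obtain ⟨a, b⟩ := ν
  fin_cases i
  · simp [polyD, unitIndex, Function.iterate_succ_apply']
  · have hcomm : Function.Commute (MvPolynomial.pderiv (R := ℝ) (1 : Fin 2))
        (MvPolynomial.pderiv (R := ℝ) (0 : Fin 2)) := fun q => by
      -- The commutator of two derivations is a derivation, and this one kills both variables.
      have h0 : ⁅MvPolynomial.pderiv (R := ℝ) (1 : Fin 2),
          MvPolynomial.pderiv (R := ℝ) (0 : Fin 2)⁆ = 0 := by
        refine MvPolynomial.derivation_ext fun j => ?_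
        rw [Derivation.commutator_apply]
        fin_cases j <;> simp [MvPolynomial.pderiv_X]
      have h1 := congrArg (fun D => D q) h0
      simpa [Derivation.commutator_apply, sub_eq_zero] using h1
    have e : ((a, b) : ℕ × ℕ) + unitIndex 1 = (a, b + 1) := by simp [unitIndex]
    change MvPolynomial.pderiv 1 (polyD (a, b) q) = polyD ((a, b) + unitIndex 1) q
    rw [e, polyD, polyD, Function.iterate_succ_apply']
    exact hcomm.iterate_right a _

/-- Truncated subtraction in the exponent is harmless: the falling factorial vanishes whenever it
truncates. -/
lemma iterate_pderiv_monomial (i : Fin 2) (n : ℕ) (s : Fin 2 →₀ ℕ) (c : ℝ) :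
    (MvPolynomial.pderiv i)^[n] (MvPolynomial.monomial s c) =
      MvPolynomial.monomial (s - Finsupp.single i n) (c * (s i).descFactorial n) := by
  induction n with
  | zero => simp
  | succ n ih =>
    rw [Function.iterate_succ_apply', ih, MvPolynomial.pderiv_monomial, tsub_tsub,
      ← Finsupp.single_add, Nat.descFactorial_succ]
    congr 1
    simp only [Finsupp.tsub_apply, Finsupp.single_eq_same]
    push_cast
    ring

lemma mem_polySpace_natCast {k : ℕ} {q : MvPolynomial (Fin 2) ℝ} :
    q ∈ polySpace (k : ℤ) ↔ q.totalDegree ≤ k := by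
  rw [polySpace, if_neg (by omega), MvPolynomial.mem_restrictTotalDegree, Int.toNat_natCast]

lemma polySpace_mono {k l : ℤ} (h : k ≤ l) : polySpace k ≤ polySpace l := by
  intro q hq
  rcases lt_or_ge k 0 with hk | hk
  · rw [polySpace, if_pos hk, Submodule.mem_bot] at hq
    rw [hq]; exact zero_mem _
  · lift k to ℕ using hk
    lift l to ℕ using by omega
    rw [mem_polySpace_natCast] at hq ⊢
    omega

/-- The derivatives of order `k` of a polynomial of degree `k` can be prescribed. -/
lemma exists_polyD_eq (k : ℕ) (a : ℕ × ℕ → ℝ) :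
    ∃ q ∈ polySpace (k : ℤ), ∀ ν ∈ Finset.HasAntidiagonal.antidiagonal k, polyD ν q = MvPolynomial.C (a ν) := by
  let s : ℕ × ℕ → (Fin 2 →₀ ℕ) := fun μ => Finsupp.single 0 μ.1 + Finsupp.single 1 μ.2
  -- Taylor coefficients: the factorials cancel those produced by differentiating the monomial.
  let c : ℕ × ℕ → ℝ := fun μ => a μ / (μ.1.factorial * μ.2.factorial)
  have hadd : ∀ (i : Fin 2) (n : ℕ) (F : ℕ × ℕ → MvPolynomial (Fin 2) ℝ) (t : Finset (ℕ × ℕ)),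
      (MvPolynomial.pderiv i)^[n] (∑ μ ∈ t, F μ) =
        ∑ μ ∈ t, (MvPolynomial.pderiv i)^[n] (F μ) := by
    intro i n F t
    induction n generalizing F with
    | zero => rfl
    | succ n ih => simp only [Function.iterate_succ_apply, map_sum, ih]
  refine ⟨∑ μ ∈ Finset.HasAntidiagonal.antidiagonal k, MvPolynomial.monomial (s μ) (c μ), ?_, fun ν hν => ?_⟩
  · refine Submodule.sum_mem _ fun μ hμ => ?_
    rw [mem_polySpace_natCast]
    refine (MvPolynomial.totalDegree_monomial_le _ _).trans ?_
    rw [← Finset.HasAntidiagonal.mem_antidiagonal.1 hμ]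
    simp [s, Finsupp.sum_fintype]
  · rw [polyD, hadd, hadd, Finset.sum_eq_single ν]
    · rw [iterate_pderiv_monomial, iterate_pderiv_monomial]
      have e1 : s ν - Finsupp.single 1 ν.2 - Finsupp.single 0 ν.1 = 0 := by
        ext i; fin_cases i <;> simp [s]
      have h1 := ν.1.factorial_ne_zero
      have h2 := ν.2.factorial_ne_zero
      rw [e1, MvPolynomial.C_apply]
      congr 1
      simp [s, c, Nat.descFactorial_self]
      field_simp
    · intro μ hμ hne
      rw [iterate_pderiv_monomial, iterate_pderiv_monomial]
      rw [Finset.HasAntidiagonal.mem_antidiagonal] at hμ hν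
      -- Distinct indices of equal order differ in both components, so one derivative exceeds its
      -- exponent and kills the monomial.
      have : μ.2 < ν.2 ∨ μ.1 < ν.1 := by
        by_contra! hcon
        exact hne (Prod.ext (by omega) (by omega))
      rcases this with h | h
      · simp [s, Nat.descFactorial_eq_zero_iff_lt.2 h]
      · simp [s, Nat.descFactorial_eq_zero_iff_lt.2 h]
    · exact fun h => absurd hν h

/-! ### The Bramble–Hilbert lemma -/

/-- `G` is the family of the weak derivatives up to order `m` of the function `G 0`. -/
structure IsWeakJet (U : Set Plane) (m : ℕ) (G : ℕ × ℕ → Plane → ℝ) : Prop where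
  memLp : ∀ ν : ℕ × ℕ, ν.1 + ν.2 ≤ m → MemLp (G ν) 2 (volume.restrict U)
  isWeakDeriv : ∀ ν : ℕ × ℕ, ν.1 + ν.2 < m → ∀ i,
    IsWeakDeriv U (unitIndex i) (G ν) (G (ν + unitIndex i))

/-- The entry at `0` is reset to `u`, because `weakD V 0 u` is a chosen representative and need not
be `u` itself. -/
lemma MemH.isWeakJet {U V : Set Plane} (hV : IsOpen V) (hUV : U ⊆ V) {m : ℕ} {u : Plane → ℝ}
    (hu : MemH m V u) : IsWeakJet U m (Function.update (fun ν => weakD V ν u) 0 u) := by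
  have hd : ∀ ν : ℕ × ℕ, ν.1 + ν.2 ≤ m →
      IsWeakDeriv V ν u (Function.update (fun ν => weakD V ν u) 0 u ν) := fun ν hν => by
    by_cases h0 : ν = 0
    · subst h0
      refine ⟨by simpa using hu.1, fun φ _ => by simp [classicalD]⟩
    · rw [Function.update_of_ne h0]
      have h := hu.2 ν hν
      simp only [weakD, dif_pos h]
      exact h.choose_spec
  refine ⟨fun ν hν => ((hd ν hν).mono hV hUV).1, fun ν hν i => ?_⟩
  refine ((hd ν hν.le).mono hV hUV).of_add_unitIndex ((hd _ ?_).mono hV hUV)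
  have := unitIndex_sum i
  simp only [Prod.fst_add, Prod.snd_add]
  omega

lemma IsWeakJet.sub_polyFun {U : Set Plane} (hb : Bornology.IsBounded U) {m : ℕ}
    {G : ℕ × ℕ → Plane → ℝ} (hG : IsWeakJet U m G) (q : MvPolynomial (Fin 2) ℝ) :
    IsWeakJet U m fun ν => G ν - polyFun (polyD ν q) :=
  ⟨fun ν hν => (hG.memLp ν hν).sub (memLp_polyFun hb _), fun ν hν i => by
    rw [← pderiv_polyD]
    exact (hG.isWeakDeriv ν hν i).sub (hG.memLp ν hν.le) (memLp_polyFun hb _)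
      (isWeakDeriv_polyFun hb i _)⟩

lemma IsWeakJet.of_le {U : Set Plane} {m n : ℕ} (h : m ≤ n)
    {G : ℕ × ℕ → Plane → ℝ} (hG : IsWeakJet U n G) : IsWeakJet U m G :=
  ⟨fun ν hν => hG.memLp ν (hν.trans h), fun ν hν => hG.isWeakDeriv ν (hν.trans_le h)⟩

/-- An index of order `k + 1` arises at most once from each of the two unit shifts. -/
lemma sum_antidiagonal_unitIndex_le (F : ℕ × ℕ → ℝ≥0∞) (k : ℕ) :
    ∑ ν ∈ Finset.HasAntidiagonal.antidiagonal k, (F (ν + unitIndex 0) + F (ν + unitIndex 1)) ≤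
      2 * ∑ ν ∈ Finset.HasAntidiagonal.antidiagonal (k + 1), F ν := by
  rw [Finset.sum_add_distrib, two_mul]
  refine add_le_add ?_ ?_
  · rw [Finset.Nat.sum_antidiagonal_succ]
    exact le_add_self
  · rw [Finset.Nat.sum_antidiagonal_succ']
    exact le_add_self

/-- The Bramble–Hilbert lemma on a domain which is star-shaped with respect to a ball. -/
lemma exists_poly_lintegral_sub_sq_le {K : Set Plane} (hK : IsOpen K)
    (hb : Bornology.IsBounded K) (hne : K.Nonempty) {c : Plane} {γ h : ℝ} (hγ : 0 < γ)
    (hh0 : 0 < h) (hstar : ∀ z ∈ Metric.ball c (γ * h), StarConvex ℝ z K)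
    (hh : ∀ x ∈ K, ∀ y ∈ K, dist x y ≤ h) (m : ℕ) {G : ℕ × ℕ → Plane → ℝ}
    (hG : IsWeakJet K m G) :
    ∃ q ∈ polySpace ((m : ℤ) - 1), ∫⁻ x in K, ‖G 0 x - polyFun q x‖ₑ ^ 2 ≤
      ENNReal.ofReal (8 * h ^ 2 * ((γ ^ 2)⁻¹ + 1)) ^ m *
        ∑ ν ∈ Finset.HasAntidiagonal.antidiagonal m, ∫⁻ x in K, ‖G ν x‖ₑ ^ 2 := by
  induction m generalizing G with
  | zero =>
    refine ⟨0, zero_mem _, ?_⟩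
    simp [polyFun]
    rfl
  | succ m ih =>
    have hex : ∀ ν : ℕ × ℕ, ∃ a : ℝ, ν ∈ Finset.HasAntidiagonal.antidiagonal m →
        ∫⁻ x in K, ‖G ν x - a‖ₑ ^ 2 ≤ ENNReal.ofReal (4 * h ^ 2 * ((γ ^ 2)⁻¹ + 1)) *
        ((∫⁻ z in K, ‖G (ν + unitIndex 0) z‖ₑ ^ 2) +
          ∫⁻ z in K, ‖G (ν + unitIndex 1) z‖ₑ ^ 2) := by
      intro ν
      by_cases hν : ν ∈ Finset.HasAntidiagonal.antidiagonal m
      · have hν' := Finset.HasAntidiagonal.mem_antidiagonal.1 hν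
        obtain ⟨a, ha⟩ := exists_const_lintegral_sub_sq_le hK hb hne hγ hh0 hstar hh
          (hG.memLp ν (by omega)) (g := fun i => G (ν + unitIndex i))
          (hG.isWeakDeriv ν (by omega))
        exact ⟨a, fun _ => ha⟩
      · exact ⟨0, fun h => absurd h hν⟩
    choose a ha using hex
    obtain ⟨q₁, hq₁, hD⟩ := exists_polyD_eq m a
    -- The jet of `G 0 - q₁` has order-`m` entries `G ν - a ν`, controlled by derivatives of order
    -- `m + 1`.
    obtain ⟨q₂, hq₂, hle⟩ := ih ((hG.of_le m.le_succ).sub_polyFun hb q₁)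
    refine ⟨q₁ + q₂, add_mem (polySpace_mono (by push_cast; omega) hq₁)
      (polySpace_mono (by push_cast; omega) hq₂), ?_⟩
    have e0 : ∀ x, G 0 x - polyFun (q₁ + q₂) x =
        (fun ν => G ν - polyFun (polyD ν q₁)) 0 x - polyFun q₂ x := fun x => by
      simp [polyFun, polyD]; ring
    simp only [e0]
    rw [pow_succ _ m]
    refine hle.trans (le_trans (mul_le_mul' le_rfl ?_) (mul_assoc _ _ _).ge)
    calc _ ≤ ∑ ν ∈ Finset.HasAntidiagonal.antidiagonal m, ENNReal.ofReal (4 * h ^ 2 * ((γ ^ 2)⁻¹ + 1)) *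
          ((∫⁻ z in K, ‖G (ν + unitIndex 0) z‖ₑ ^ 2) +
            ∫⁻ z in K, ‖G (ν + unitIndex 1) z‖ₑ ^ 2) := by
          refine Finset.sum_le_sum fun ν hν => ?_
          refine le_trans (le_of_eq ?_) (ha ν hν)
          simp [hD ν hν, polyFun]
      _ ≤ ENNReal.ofReal (4 * h ^ 2 * ((γ ^ 2)⁻¹ + 1)) *
          (2 * ∑ ν ∈ Finset.HasAntidiagonal.antidiagonal (m + 1), ∫⁻ x in K, ‖G ν x‖ₑ ^ 2) := by
          rw [← Finset.mul_sum]
          gcongr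
          exact sum_antidiagonal_unitIndex_le (fun ν => ∫⁻ x in K, ‖G ν x‖ₑ ^ 2) m
      _ = _ := by
          rw [← mul_assoc, show 8 * h ^ 2 * ((γ ^ 2)⁻¹ + 1) = 4 * h ^ 2 * ((γ ^ 2)⁻¹ + 1) * 2 by ring,
            ENNReal.ofReal_mul (by positivity) (q := 2), ENNReal.ofReal_ofNat]

/-! ### Geometry of meshes -/

namespace PolygonalDomain

lemma volume_frontier (K : PolygonalDomain) : volume (frontier K.carrier) = 0 := by
  rw [K.frontier_carrier, Polygon.boundary]
  refine measure_iUnion_null fun i => ?_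
  refine measure_mono_null (t := line[ℝ, K.chain i, K.chain (finRotate K.n i)])
    (fun x hx => Wbtw.mem_affineSpan hx) (Measure.addHaar_affineSubspace _ _ fun htop => ?_)
  have h1 := (collinear_pair ℝ (K.chain i) (K.chain (finRotate K.n i))).finrank_le_one
  rw [← direction_affineSpan, htop, AffineSubspace.direction_top, finrank_top,
    finrank_euclideanSpace_fin] at h1
  norm_num at h1

lemma diam_pos (K : PolygonalDomain) : 0 < K.diam := by
  obtain ⟨x, hx⟩ := K.isConnected_carrier.nonempty
  exact Metric.diam_pos (infinite_of_mem_nhds x (K.isOpen_carrier.mem_nhds hx)).nontrivial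
    K.isBounded_carrier

lemma memLp_polyFun (K : PolygonalDomain) (q : MvPolynomial (Fin 2) ℝ) :
    MemLp (polyFun q) 2 (volume.restrict K.carrier) :=
  PolyVEM.memLp_polyFun K.isBounded_carrier q

end PolygonalDomain

namespace Mesh

variable {Ω : PolygonalDomain} (T : Mesh Ω)

/-- The covering condition only places cells in the closure of `Ω`; an open convex set is the
interior of its closure. -/
lemma cell_subset (hΩ : Convex ℝ Ω.carrier) (i : Fin T.card) :
    (T.cell i).carrier ⊆ Ω.carrier := by
  have hne : (interior Ω.carrier).Nonempty := by
    rw [Ω.isOpen_carrier.interior_eq]; exact Ω.isConnected_carrier.nonempty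
  rw [← Ω.isOpen_carrier.interior_eq, ← hΩ.interior_closure_eq_interior_of_nonempty_interior hne,
    ← T.covers]
  exact interior_maximal (subset_closure.trans
    (subset_iUnion (fun i => closure (T.cell i).carrier) i)) (T.cell i).isOpen_carrier

lemma diam_le_size (i : Fin T.card) : (T.cell i).diam ≤ T.size :=
  le_ciSup (f := fun i => (T.cell i).diam) (Set.finite_range _).bddAbove i

lemma size_nonneg : 0 ≤ T.size := Real.iSup_nonneg fun _ => Metric.diam_nonneg

/-- Points of `Ω` in no cell lie on the frontier of one, and frontiers consist of finitely many
segments. -/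
lemma iUnion_cell_ae_eq (hΩ : Convex ℝ Ω.carrier) :
    (⋃ i, (T.cell i).carrier) =ᵐ[volume] Ω.carrier := by
  refine ae_eq_set.2 ⟨?_, ?_⟩
  · rw [sdiff_eq_empty.2 (iUnion_subset (T.cell_subset hΩ)), measure_empty]
  · refine measure_mono_null (t := ⋃ i, frontier (T.cell i).carrier) (fun x hx => ?_)
      (measure_iUnion_null fun i => (T.cell i).volume_frontier)
    have h1 : x ∈ ⋃ i, closure (T.cell i).carrier := by
      rw [T.covers]; exact subset_closure hx.1
    obtain ⟨i, hi⟩ := mem_iUnion.1 h1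
    refine mem_iUnion.2 ⟨i, hi, fun hx' => hx.2 (mem_iUnion.2 ⟨i, interior_subset hx'⟩)⟩

lemma integral_eq_sum (hΩ : Convex ℝ Ω.carrier) {F : Plane → ℝ}
    (hF : IntegrableOn F Ω.carrier) :
    ∫ x in Ω.carrier, F x = ∑ i, ∫ x in (T.cell i).carrier, F x := by
  rw [← setIntegral_congr_set (T.iUnion_cell_ae_eq hΩ)]
  exact integral_iUnion_fintype (fun i => (T.cell i).isOpen_carrier.measurableSet)
    (fun i j hij => T.nonoverlapping i j hij) (fun i => hF.mono_set (T.cell_subset hΩ i))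

end Mesh

/-! ### Local estimates -/

lemma lintegral_enorm_sq {α : Type*} [MeasurableSpace α] {μ : Measure α} {a : α → ℝ}
    (ha : MemLp a 2 μ) : ∫⁻ x, ‖a x‖ₑ ^ 2 ∂μ = ENNReal.ofReal (∫ x, a x ^ 2 ∂μ) := by
  rw [ofReal_integral_eq_lintegral_ofReal ha.integrable_sq
    (Eventually.of_forall fun x => sq_nonneg _)]
  refine lintegral_congr fun x => ?_
  rw [← ofReal_norm, ← ENNReal.ofReal_pow (norm_nonneg _), Real.norm_eq_abs, sq_abs]

lemma integral_mul_le_sqrt_mul_sqrt {α : Type*} [MeasurableSpace α] {μ : Measure α}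
    {a b : α → ℝ} (ha : MemLp a 2 μ) (hb : MemLp b 2 μ) :
    ∫ x, a x * b x ∂μ ≤ √(∫ x, a x ^ 2 ∂μ) * √(∫ x, b x ^ 2 ∂μ) := by
  have h := integral_mul_norm_le_Lp_mul_Lq (μ := μ) Real.HolderConjugate.two_two
    (f := a) (g := b) (by simpa using ha) (by simpa using hb)
  have h1 : ∫ x, a x * b x ∂μ ≤ ∫ x, ‖a x‖ * ‖b x‖ ∂μ := by
    simp only [← norm_mul]
    exact (Real.le_norm_self _).trans (norm_integral_le_integral_norm _)
  refine h1.trans (h.trans (le_of_eq ?_))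
  simp only [Real.rpow_two, Real.norm_eq_abs, sq_abs, Real.sqrt_eq_rpow]

/-- Pythagoras: `f - q` splits into `f - P` and the polynomial `P - q`, orthogonal to it. -/
lemma integral_sub_l2Projection_sq_le (K : PolygonalDomain) (k : ℤ) {f : Plane → ℝ}
    (hf : MemLp f 2 (volume.restrict K.carrier)) {q : MvPolynomial (Fin 2) ℝ}
    (hq : q ∈ polySpace k) :
    ∫ x in K.carrier, (f x - polyFun (l2Projection K.carrier k f) x) ^ 2 ≤
      ∫ x in K.carrier, (f x - polyFun q x) ^ 2 := by
  obtain ⟨hmem, horth⟩ := isL2Projection_l2Projection K.isBounded_carrier k hf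
  set P := l2Projection K.carrier k f
  have h0 := horth _ (Submodule.sub_mem _ hmem hq)
  have hfP : MemLp (f - polyFun P) 2 (volume.restrict K.carrier) := hf.sub (K.memLp_polyFun _)
  have hPq := K.memLp_polyFun (P - q)
  have e : ∀ x, (f x - polyFun q x) ^ 2 = (f x - polyFun P x) ^ 2 +
      (2 * ((f x - polyFun P x) * polyFun (P - q) x) + polyFun (P - q) x ^ 2) := fun x => by
    simp only [polyFun, map_sub]; ring
  simp only [e]
  have i1 := hfP.integrable_sq
  have i2 := hfP.integrable_mul hPq
  have i3 := hPq.integrable_sq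
  simp only [Pi.sub_apply] at i1
  have i2' : Integrable (fun x => 2 * ((f x - polyFun P x) * polyFun (P - q) x))
    (volume.restrict K.carrier) := i2.const_mul 2
  have i4 : Integrable (fun x => 2 * ((f x - polyFun P x) * polyFun (P - q) x) +
    polyFun (P - q) x ^ 2) (volume.restrict K.carrier) := i2'.add i3
  rw [integral_add i1 i4, integral_add i2' i3, integral_const_mul, h0]
  have : 0 ≤ ∫ x in K.carrier, polyFun (P - q) x ^ 2 := integral_nonneg fun x => sq_nonneg _
  linarith

lemma memLp_weakD {U V : Set Plane} (hUV : U ⊆ V) {m : ℕ} {u : Plane → ℝ} (hu : MemH m V u)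
    {ν : ℕ × ℕ} (hν : ν.1 + ν.2 ≤ m) : MemLp (weakD V ν u) 2 (volume.restrict U) := by
  have h := hu.2 ν hν
  simp only [weakD, dif_pos h]
  exact h.choose_spec.1.mono_measure (Measure.restrict_mono hUV le_rfl)

/-- Polynomial approximation on a star-shaped polygon. -/
lemma exists_poly_integral_sub_sq_le (K : PolygonalDomain) {V : Set Plane} (hV : IsOpen V)
    (hKV : K.carrier ⊆ V) {γ : ℝ} (hγ : 0 < γ)
    (hstar : ∃ c : Plane, ∀ z ∈ Metric.ball c (γ * K.diam), StarConvex ℝ z K.carrier)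
    {m : ℕ} (hm : 0 < m) {u : Plane → ℝ} (hu : MemH m V u) :
    ∃ q ∈ polySpace ((m : ℤ) - 1), ∫ x in K.carrier, (u x - polyFun q x) ^ 2 ≤
      (8 * ((γ ^ 2)⁻¹ + 1) * K.diam ^ 2) ^ m *
        ∑ ν ∈ Finset.HasAntidiagonal.antidiagonal m, ∫ x in K.carrier, weakD V ν u x ^ 2 := by
  obtain ⟨c, hc⟩ := hstar
  obtain ⟨q, hq, hle⟩ := exists_poly_lintegral_sub_sq_le K.isOpen_carrier K.isBounded_carrier
    K.isConnected_carrier.nonempty hγ K.diam_pos hc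
    (fun x hx y hy => Metric.dist_le_diam_of_mem K.isBounded_carrier hx hy) m
    (hu.isWeakJet hV hKV)
  refine ⟨q, hq, ?_⟩
  have hnn : 0 ≤ ∑ ν ∈ Finset.HasAntidiagonal.antidiagonal m,
      ∫ x in K.carrier, weakD V ν u x ^ 2 :=
    Finset.sum_nonneg fun ν _ => integral_nonneg fun x => sq_nonneg _
  have hsum : ∑ ν ∈ Finset.HasAntidiagonal.antidiagonal m, ∫⁻ x in K.carrier,
      ‖Function.update (fun ν => weakD V ν u) 0 u ν x‖ₑ ^ 2 =
      ENNReal.ofReal (∑ ν ∈ Finset.HasAntidiagonal.antidiagonal m,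
        ∫ x in K.carrier, weakD V ν u x ^ 2) := by
    rw [ENNReal.ofReal_sum_of_nonneg fun ν _ => integral_nonneg fun x => sq_nonneg _]
    refine Finset.sum_congr rfl fun ν hν => ?_
    have hν' := Finset.HasAntidiagonal.mem_antidiagonal.1 hν
    have h0 : ν ≠ 0 := by
      rintro rfl
      simp at hν'
      omega
    simp only [Function.update_of_ne h0]
    exact lintegral_enorm_sq (memLp_weakD hKV hu hν'.le)
  have huq : MemLp (u - polyFun q) 2 (volume.restrict K.carrier) :=
    (hu.1.mono_measure (Measure.restrict_mono hKV le_rfl)).sub (K.memLp_polyFun q)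
  have hlhs := lintegral_enorm_sq huq
  simp only [Pi.sub_apply] at hlhs
  rw [hsum, Function.update_self, hlhs, ← ENNReal.ofReal_pow (by positivity),
    ← ENNReal.ofReal_mul (by positivity),
    ENNReal.ofReal_le_ofReal_iff (mul_nonneg (by positivity) hnn)] at hle
  refine hle.trans (le_of_eq ?_)
  congr 2
  ring

/-- The consistency error of the load term on one element. -/
lemma integral_sub_l2Projection_mul_le (K : PolygonalDomain) {k : ℤ} {f v : Plane → ℝ}
    (hf : MemLp f 2 (volume.restrict K.carrier)) (hv : MemLp v 2 (volume.restrict K.carrier))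
    {qf qv : MvPolynomial (Fin 2) ℝ} (hqf : qf ∈ polySpace k) (hqv : qv ∈ polySpace k) :
    (∫ x in K.carrier, f x * v x) - ∫ x in K.carrier, polyFun (l2Projection K.carrier k f) x * v x ≤
      √(∫ x in K.carrier, (f x - polyFun qf x) ^ 2) *
        √(∫ x in K.carrier, (v x - polyFun qv x) ^ 2) := by
  have horth := (isL2Projection_l2Projection K.isBounded_carrier k hf).2 qv hqv
  have hmin := integral_sub_l2Projection_sq_le K k hf hqf
  set P := l2Projection K.carrier k f
  have hfP : MemLp (f - polyFun P) 2 (volume.restrict K.carrier) := hf.sub (K.memLp_polyFun _)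
  have hvq : MemLp (v - polyFun qv) 2 (volume.restrict K.carrier) := hv.sub (K.memLp_polyFun _)
  -- Orthogonality allows `qv` to be subtracted from `v` for free.
  have e1 : (∫ x in K.carrier, f x * v x) - ∫ x in K.carrier, polyFun P x * v x =
      ∫ x in K.carrier, (f - polyFun P) x * (v - polyFun qv) x := by
    have i1 : Integrable (fun x => f x * v x) (volume.restrict K.carrier) := hf.integrable_mul hv
    have i2 : Integrable (fun x => polyFun P x * v x) (volume.restrict K.carrier) :=
      (K.memLp_polyFun P).integrable_mul hv
    have i3 : Integrable (fun x => (f x - polyFun P x) * polyFun qv x)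
      (volume.restrict K.carrier) := hfP.integrable_mul (K.memLp_polyFun qv)
    have i4 : Integrable (fun x => f x * v x - polyFun P x * v x)
      (volume.restrict K.carrier) := i1.sub i2
    rw [← integral_sub i1 i2, ← sub_zero (∫ x in K.carrier, (f x * v x - polyFun P x * v x)),
      ← horth, ← integral_sub i4 i3]
    refine integral_congr_ae (Eventually.of_forall fun x => ?_)
    simp only [Pi.sub_apply]
    ring
  rw [e1]
  refine (integral_mul_le_sqrt_mul_sqrt hfP hvq).trans ?_
  simp only [Pi.sub_apply]
  gcongr

/-! ### The global estimate -/

/-- The weak derivatives are taken once on `Ω` and restricted to the cells, so the sum is plain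
additivity of the integral. -/
lemma Mesh.sum_seminorm_le {Ω : PolygonalDomain} (T : Mesh Ω) (hΩ : Convex ℝ Ω.carrier) {m : ℕ}
    {u : Plane → ℝ} (hu : MemH m Ω.carrier u) :
    ∑ i, ∑ ν ∈ Finset.HasAntidiagonal.antidiagonal m,
      ∫ x in (T.cell i).carrier, weakD Ω.carrier ν u x ^ 2 = seminormH m Ω.carrier u ^ 2 := by
  rw [seminormH, Real.sq_sqrt (Finset.sum_nonneg fun ν _ => integral_nonneg fun x => sq_nonneg _),
    Finset.sum_comm]
  refine Finset.sum_congr rfl fun ν hν => ?_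
  exact (T.integral_eq_sum hΩ (memLp_weakD subset_rfl hu
    (Finset.HasAntidiagonal.mem_antidiagonal.1 hν).le).integrable_sq).symm

lemma seminormH_nonneg (m : ℕ) (U : Set Plane) (u : Plane → ℝ) : 0 ≤ seminormH m U u :=
  Real.sqrt_nonneg _

/-- Piecewise polynomial approximation on a regular mesh. -/
lemma Mesh.exists_poly_sum_sub_sq_le {Ω : PolygonalDomain} (T : Mesh Ω)
    (hΩ : Convex ℝ Ω.carrier) {γ : ℝ} (hγ : 0 < γ) (hT : T.IsRegular γ) {m : ℕ} (hm : 0 < m)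
    {u : Plane → ℝ} (hu : MemH m Ω.carrier u) :
    ∃ q : Fin T.card → MvPolynomial (Fin 2) ℝ, (∀ i, q i ∈ polySpace ((m : ℤ) - 1)) ∧
      √(∑ i, ∫ x in (T.cell i).carrier, (u x - polyFun (q i) x) ^ 2) ≤
        (√(8 * ((γ ^ 2)⁻¹ + 1)) * T.size) ^ m * seminormH m Ω.carrier u := by
  choose q hq hle using fun i => exists_poly_integral_sub_sq_le (T.cell i) Ω.isOpen_carrier
    (T.cell_subset hΩ i) hγ (hT i) hm hu
  refine ⟨q, hq, Real.sqrt_le_iff.2 ⟨mul_nonneg (pow_nonneg (mul_nonneg (Real.sqrt_nonneg _)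
    T.size_nonneg) _) (seminormH_nonneg _ _ _), ?_⟩⟩
  calc _ ≤ ∑ i, (8 * ((γ ^ 2)⁻¹ + 1) * T.size ^ 2) ^ m *
        ∑ ν ∈ Finset.HasAntidiagonal.antidiagonal m,
          ∫ x in (T.cell i).carrier, weakD Ω.carrier ν u x ^ 2 := by
        refine Finset.sum_le_sum fun i _ => (hle i).trans ?_
        have h1 := T.diam_le_size i
        have h2 := (T.cell i).diam_pos
        have h3 : 0 ≤ ∑ ν ∈ Finset.HasAntidiagonal.antidiagonal m,
            ∫ x in (T.cell i).carrier, weakD Ω.carrier ν u x ^ 2 :=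
          Finset.sum_nonneg fun ν _ => integral_nonneg fun x => sq_nonneg _
        gcongr
    _ = _ := by
        rw [← Finset.mul_sum, T.sum_seminorm_le hΩ hu, mul_pow _ (seminormH _ _ _), pow_right_comm,
          mul_pow _ T.size, Real.sq_sqrt (by positivity)]

end PolyVEM

theorem mainTheorem4 (Ω : PolyVEM.PolygonalDomain) (hΩ : Convex ℝ Ω.carrier)
    (p r : ℕ) (hp : 1 ≤ p) (hr : 2 * p - 1 ≤ r) (γ : ℝ) (hγ : 0 < γ) :
    ∃ C : ℝ, 0 < C ∧ ∀ T : PolyVEM.Mesh Ω, T.IsRegular γ →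
      ∀ f : EuclideanSpace ℝ (Fin 2) → ℝ, PolyVEM.MemH (r + 1 - p) Ω.carrier f →
      ∀ v : EuclideanSpace ℝ (Fin 2) → ℝ, PolyVEM.MemGlobalVEM p r T v →
        PolyVEM.loadPairing Ω f v - PolyVEM.discreteLoadPairing T ((r : ℤ) - p) f v ≤
          C * T.size ^ (r + 1) * PolyVEM.seminormH (r + 1 - p) Ω.carrier f *
            PolyVEM.seminormH p Ω.carrier v := by
  -- `r + 1 - p` factors of the root come from approximating `f`, and `p` from approximating `v`.
  refine ⟨√(8 * ((γ ^ 2)⁻¹ + 1)) ^ (r + 1), by positivity, fun T hT f hf v hv => ?_⟩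
  have hv' : PolyVEM.MemH p Ω.carrier v := hv.1.1
  obtain ⟨qf, hqf, hle_f⟩ := T.exists_poly_sum_sub_sq_le hΩ hγ hT (by omega) hf
  obtain ⟨qv, hqv, hle_v⟩ := T.exists_poly_sum_sub_sq_le hΩ hγ hT hp hv'
  have hload : PolyVEM.loadPairing Ω f v =
      ∑ i, ∫ x in (T.cell i).carrier, f x * v x :=
    T.integral_eq_sum hΩ (hf.1.integrable_mul hv'.1)
  have hmono : ∀ i, volume.restrict (T.cell i).carrier ≤ volume.restrict Ω.carrier := fun i =>
    Measure.restrict_mono (T.cell_subset hΩ i) le_rfl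
  have hk : ((r + 1 - p : ℕ) : ℤ) - 1 = (r : ℤ) - p := by omega
  -- The condition `r ≥ 2p - 1` makes the approximants of `v` admissible in the orthogonality
  -- relation.
  have hkp : (p : ℤ) - 1 ≤ (r : ℤ) - p := by omega
  rw [hk] at hqf
  rw [hload, PolyVEM.discreteLoadPairing, ← Finset.sum_sub_distrib]
  calc _ ≤ ∑ i, √(∫ x in (T.cell i).carrier, (f x - PolyVEM.polyFun (qf i) x) ^ 2) *
          √(∫ x in (T.cell i).carrier, (v x - PolyVEM.polyFun (qv i) x) ^ 2) :=
        Finset.sum_le_sum fun i _ => PolyVEM.integral_sub_l2Projection_mul_le (T.cell i)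
          (hf.1.mono_measure (hmono i)) (hv'.1.mono_measure (hmono i))
          (hqf i) (PolyVEM.polySpace_mono hkp (hqv i))
    _ ≤ √(∑ i, ∫ x in (T.cell i).carrier, (f x - PolyVEM.polyFun (qf i) x) ^ 2) *
          √(∑ i, ∫ x in (T.cell i).carrier, (v x - PolyVEM.polyFun (qv i) x) ^ 2) :=
        Real.sum_sqrt_mul_sqrt_le _ (fun i => integral_nonneg fun x => sq_nonneg _)
          (fun i => integral_nonneg fun x => sq_nonneg _)
    _ ≤ _ := mul_le_mul hle_f hle_v (Real.sqrt_nonneg _)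
        (mul_nonneg (pow_nonneg (mul_nonneg (Real.sqrt_nonneg _) T.size_nonneg) _)
          (PolyVEM.seminormH_nonneg _ _ _))
    _ = _ := by
        have e : ∀ x : ℝ, x ^ (r + 1) = x ^ (r + 1 - p) * x ^ p := fun x => by
          rw [← pow_add]; congr 1; omega
        rw [e, e, mul_pow, mul_pow]
        ring
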